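/- **Theorem 3.2.** Let $(\mathcal T,d)$ be a compact metric space and let $\delta>0$, $\theta>0$ and $0<\rho<1$ be real numbers. For each $n\in\mathbb N=\{1,2,\dots\}$ let $\mathcal T_n\subseteq\mathcal T$ be a set of centres of a minimal covering of $\mathcal T$ by closed balls of radius $r_n=\theta\rho^{n-1}$, that is, a covering with the least possible number $N_{r_n}$ of such balls. For $x\neq y$ in $\mathcal T$ the two-point triple $ST_{x,y}$ consists of the Hilbert space $\mathbb C^2$, the representation $\pi_{x,y}(f)(\alpha,\beta)=(f(x)\alpha,f(y)\beta)$ of $C(\mathcal T)$ and the operator $D_{x,y}(\alpha,\beta)=\bigl(\beta/d(x,y),\alpha/d(x,y)\bigr)$. Then there is a countable set $\mathcal J$ of unordered pairs $\{x,y\}$ of distinct points of $\mathcal T$, each with $x\in\mathcal T_n$ and $y\in\mathcal T_n\cup\mathcal T_{n+1}$ for some $n$, such that the direct sum $(C(\mathcal T),H,D)$, with representation $\pi$, of the triples $ST_{x,y}$ over $\{x,y\}\in\mathcal J$ has the following properties. 1. It is a spectral triple: $D$ is self-adjoint, the set of $f\in C(\mathcal T)$ for which $[D,\pi(f)]$ is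 bounded is dense in $C(\mathcal T)$, and $(I+D^2)^{-1}$ is compact. 2. The function $d_\delta(s,t)=\sup\{|f(s)-f(t)| : f\in C(\mathcal T),\ \|[D,\pi(f)]\|\le 1\}$, which is the distance induced by the triple between the point evaluations at $s$ and $t$, is a metric on $\mathcal T$, and $d(s,t)\le d_\delta(s,t)\le(1+\delta)\,d(s,t)$ for all $s,t\in\mathcal T$. 3. If the upper Minkowski dimension $\overline{\dim}_M(\mathcal T)=\limsup_{r\to0}\frac{\log N_r}{-\log r}$ is finite, then $\operatorname{tr}\bigl((I+D^2)^{-s/2}\bigr)<\infty$ for every real $s>2\,\overline{\dim}_M(\mathcal T)$. 4. If $\mathcal T$ is connected and $\operatorname{tr}\bigl((I+D^2)^{-s/2}\bigr)<\infty$ for some real $s>0$, then $\overline{\dim}_M(\mathcal T)\le s$. -/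

import Mathlib

open scoped ENNReal NNReal InnerProductSpace ComplexOrder

noncomputable section

namespace SpectralTriple

universe u v w

section General

variable {A : Type v} [CStarAlgebra A]
variable {H : Type u} [NormedAddCommGroup H] [InnerProductSpace ℂ H] [CompleteSpace H]

/-- `‖[D, π a]‖ ≤ c`: the operator `π a` maps the domain of `D` into itself, and the commutator
`D (π a) - (π a) D`, an operator on the domain of `D`, is bounded by `c`. -/
def CommutatorNormLE (π : A →⋆ₐ[ℂ] (H →L[ℂ] H)) (D : H →ₗ.[ℂ] H) (a : A) (c : ℝ) : Prop :=
  ∀ ξ : D.domain, ∃ h : π a (ξ : H) ∈ D.domain,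
    ‖D ⟨π a (ξ : H), h⟩ - π a (D ξ)‖ ≤ c * ‖(ξ : H)‖

/-- `R = (I + D²)⁻¹`: for all `ξ, η`, we have `R η = ξ` if and only if `ξ` lies in the domain of
`D²` and `ξ + D (D ξ) = η`. -/
def IsInvOneAddSq (D : H →ₗ.[ℂ] H) (R : H →L[ℂ] H) : Prop :=
  ∀ ξ η : H, R η = ξ ↔
    ∃ (h₁ : ξ ∈ D.domain) (h₂ : D ⟨ξ, h₁⟩ ∈ D.domain), ξ + D ⟨D ⟨ξ, h₁⟩, h₂⟩ = η

/-- `(A, H, D)` is a spectral triple, where `A` is a unital C*-algebra represented on `H` by the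
unital *-representation `π`. -/
structure IsSpectralTriple (π : A →⋆ₐ[ℂ] (H →L[ℂ] H)) (D : H →ₗ.[ℂ] H) : Prop where
  dense_domain : Dense (D.domain : Set H)
  selfAdjoint : IsSelfAdjoint D
  dense_bounded_commutator : Dense {a : A | ∃ c : ℝ, CommutatorNormLE π D a c}
  compact_resolvent : ∃ R : H →L[ℂ] H, IsInvOneAddSq D R ∧ IsCompactOperator R

/-- For a positive operator `P`: the trace of `P` is finite, that is, the series of the diagonal
entries `⟪e i, P (e i)⟫` with respect to any orthonormal basis `e` converges. -/
def HasFiniteTrace (P : H →L[ℂ] H) : Prop :=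
  ∀ (ι : Type u) (e : HilbertBasis ι ℂ H), Summable fun i => (⟪e i, P (e i)⟫_ℂ).re

/-- `p`-summability: `p` is positive and `tr ((I + D²) ^ (-p / 2)) < ∞`. The power of the bounded
positive operator `(I + D²)⁻¹` is taken in the continuous functional calculus. -/
def IsSummable (D : H →ₗ.[ℂ] H) (p : ℝ) : Prop :=
  0 < p ∧ ∃ R : H →L[ℂ] H, IsInvOneAddSq D R ∧ HasFiniteTrace (R ^ (p / 2))

/-- The state space of a unital C*-algebra: positive linear functionals with value `1` at the
unit. -/
def StateSpace (A : Type v) [CStarAlgebra A] : Type v :=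
  {φ : A →L[ℂ] ℂ // φ 1 = 1 ∧ ∀ a : A, 0 ≤ φ (star a * a)}

/-- The (possibly infinite) distance on the state space induced by `D`:
the supremum of `|φ a - ψ a|` over all `a` with `‖[D, π a]‖ ≤ 1`. -/
def inducedDist (π : A →⋆ₐ[ℂ] (H →L[ℂ] H)) (D : H →ₗ.[ℂ] H) (φ ψ : StateSpace A) : ℝ≥0∞ :=
  ⨆ (a : A) (_ : CommutatorNormLE π D a 1), ‖φ.1 a - ψ.1 a‖ₑ

end General

section Sum

variable {A : Type v} [CStarAlgebra A]
variable {ι : Type w} {H : ι → Type u} [∀ i, NormedAddCommGroup (H i)]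
  [∀ i, InnerProductSpace ℂ (H i)] [∀ i, CompleteSpace (H i)]

theorem memℓp_sumRep (π : ∀ i, A →⋆ₐ[ℂ] (H i →L[ℂ] H i)) (a : A) (ξ : lp H 2) :
    Memℓp (fun i => π i a (ξ i)) 2 := by
  refine Memℓp.mono (g := fun i => ‖a‖ * ‖ξ i‖) ?_ fun i => ?_
  · exact ((lp.memℓp ξ).norm).const_mul ‖a‖
  · exact (π i a).le_of_opNorm_le (NonUnitalStarAlgHom.norm_apply_le (π i) a) (ξ i)

/-- The operator `⨁ i, π i a` on the Hilbert space sum of the `H i`. -/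
def sumRepOp (π : ∀ i, A →⋆ₐ[ℂ] (H i →L[ℂ] H i)) (a : A) : lp H 2 →L[ℂ] lp H 2 :=
  LinearMap.mkContinuous
    { toFun := fun ξ => ⟨fun i => π i a (ξ i), memℓp_sumRep π a ξ⟩
      map_add' := fun ξ η => by ext i : 2; exact map_add (π i a) (ξ i) (η i)
      map_smul' := fun c ξ => by ext i : 2; exact map_smul (π i a) c (ξ i) } ‖a‖
    fun ξ => by
      have h : ‖(⟨fun i => π i a (ξ i), memℓp_sumRep π a ξ⟩ : lp H 2)‖ ≤
          ‖(((‖a‖ : ℝ) : ℂ) • ξ : lp H 2)‖ := by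
        refine lp.norm_mono (by norm_num) fun i => ?_
        rw [lp.coeFn_smul, Pi.smul_apply, norm_smul, Complex.norm_real, norm_norm]
        exact (π i a).le_of_opNorm_le (NonUnitalStarAlgHom.norm_apply_le (π i) a) (ξ i)
      rwa [norm_smul, Complex.norm_real, norm_norm] at h

/-- The direct sum of a family of unital *-representations. -/
def sumRep (π : ∀ i, A →⋆ₐ[ℂ] (H i →L[ℂ] H i)) : A →⋆ₐ[ℂ] (lp H 2 →L[ℂ] lp H 2) where
  toFun := sumRepOp π
  map_one' := by ext ξ i; simp [sumRepOp]
  map_mul' a b := by ext ξ i; simp [sumRepOp]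
  map_zero' := by ext ξ i; simp [sumRepOp]
  map_add' a b := by ext ξ i; simp [sumRepOp]; rfl
  commutes' c := by ext ξ i; simp [sumRepOp, Algebra.algebraMap_eq_smul_one]
  map_star' a := by
    rw [ContinuousLinearMap.star_eq_adjoint, ContinuousLinearMap.eq_adjoint_iff]
    intro ξ η
    simp [lp.inner_eq_tsum, sumRepOp, map_star, ContinuousLinearMap.star_eq_adjoint,
      ContinuousLinearMap.adjoint_inner_left]

/-- The direct sum of a family of bounded operators `D i`, as an unbounded operator on the Hilbert
space sum: its domain consists of all `ξ` with `∑ i, ‖D i (ξ i)‖² < ∞`, and it acts there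
componentwise. (For self-adjoint `D i` this is the closure of the sum on the algebraic direct
sum of the `H i`.) -/
def sumOp (D : ∀ i, H i →L[ℂ] H i) : lp H 2 →ₗ.[ℂ] lp H 2 where
  domain :=
    { carrier := {ξ | Memℓp (fun i => D i (ξ i)) 2}
      add_mem' := fun {ξ η} hξ hη => by
        have h := Memℓp.add hξ hη
        have e : (fun i => D i ((ξ + η : lp H 2) i)) =
            (fun i => D i (ξ i)) + fun i => D i (η i) := by
          ext i; exact map_add (D i) (ξ i) (η i)
        rw [← e] at h; exact h
      zero_mem' := by
        have e : (fun i => D i ((0 : lp H 2) i)) = 0 := by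
          ext i; exact map_zero (D i)
        have h : Memℓp (0 : ∀ i, H i) 2 := zero_memℓp
        rw [← e] at h; exact h
      smul_mem' := fun c ξ hξ => by
        have h := Memℓp.const_smul hξ c
        have e : (fun i => D i ((c • ξ : lp H 2) i)) = c • fun i => D i (ξ i) := by
          ext i; exact map_smul (D i) c (ξ i)
        rw [← e] at h; exact h }
  toFun :=
    { toFun := fun ξ => ⟨fun i => D i ((ξ : lp H 2) i), ξ.2⟩
      map_add' := fun ξ η => by ext i : 2; exact map_add (D i) _ _
      map_smul' := fun c ξ => by ext i : 2; exact map_smul (D i) c _ }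

end Sum

section TwoPoint

variable {T : Type u} [MetricSpace T] [CompactSpace T]

/-- The representation `f ↦ diag (f x, f y)` of `C(T)` on `ℂ²`. -/
def twoPointRep (x y : T) :
    C(T, ℂ) →⋆ₐ[ℂ] (EuclideanSpace ℂ (Fin 2) →L[ℂ] EuclideanSpace ℂ (Fin 2)) where
  toFun f := Matrix.toEuclideanCLM (𝕜 := ℂ) (Matrix.diagonal ![f x, f y])
  map_one' := by
    rw [← map_one (Matrix.toEuclideanCLM (n := Fin 2) (𝕜 := ℂ))]
    congr 1; ext i j; fin_cases i <;> fin_cases j <;> simp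
  map_mul' f g := by
    rw [← map_mul]; congr 1; ext i j; fin_cases i <;> fin_cases j <;> simp
  map_zero' := by
    rw [← map_zero (Matrix.toEuclideanCLM (n := Fin 2) (𝕜 := ℂ))]
    congr 1; ext i j; fin_cases i <;> fin_cases j <;> simp
  map_add' f g := by
    rw [← map_add]; congr 1; ext i j; fin_cases i <;> fin_cases j <;> simp
  commutes' c := by
    rw [← AlgHomClass.commutes (Matrix.toEuclideanCLM (n := Fin 2) (𝕜 := ℂ)) c]
    congr 1; ext i j; fin_cases i <;> fin_cases j <;> simp [Matrix.algebraMap_matrix_apply]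
  map_star' f := by
    rw [← map_star]; congr 1; ext i j
    fin_cases i <;> fin_cases j <;> simp

/-- The Dirac operator `(α, β) ↦ (β / d(x, y), α / d(x, y))` of the two-point spectral triple of
two distinct points `x, y`. -/
def twoPointDirac (x y : T) : EuclideanSpace ℂ (Fin 2) →L[ℂ] EuclideanSpace ℂ (Fin 2) :=
  Matrix.toEuclideanCLM (𝕜 := ℂ)
    !![0, ((dist x y : ℝ) : ℂ)⁻¹; ((dist x y : ℝ) : ℂ)⁻¹, 0]

/-- The Hilbert space sum of one copy of `ℂ²` for each pair in `J`. -/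
abbrev PairSpace (J : Set (T × T)) : Type u :=
  lp (fun _ : J => EuclideanSpace ℂ (Fin 2)) 2

/-- The representation of `C(T)` in the sum of the two-point triples over `J`. -/
def pairRep (J : Set (T × T)) : C(T, ℂ) →⋆ₐ[ℂ] (PairSpace J →L[ℂ] PairSpace J) :=
  sumRep fun p : J => twoPointRep p.1.1 p.1.2

/-- The Dirac operator of the sum of the two-point triples over `J`. -/
def pairDirac (J : Set (T × T)) : PairSpace J →ₗ.[ℂ] PairSpace J :=
  sumOp fun p : J => twoPointDirac p.1.1 p.1.2

/-- The evaluation at `t` (the point mass at `t`) as a state of `C(T)`. -/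
def pointState (t : T) : StateSpace C(T, ℂ) :=
  ⟨ContinuousMap.evalCLM ℂ t, by simp, fun f => by
    simpa using star_mul_self_nonneg (f t)⟩

end TwoPoint

section Covering

variable {T : Type u} [MetricSpace T]

/-- `C` is a set of centres of a minimal covering of `T` by closed balls of radius `r`. -/
def IsMinimalCentres (r : ℝ≥0) (C : Set T) : Prop :=
  Metric.IsCover r Set.univ C ∧ C.encard = Metric.coveringNumber r (Set.univ : Set T)

/-- In a compact space minimal coverings exist, and they are finite. -/
theorem exists_isMinimalCentres [CompactSpace T] {r : ℝ≥0} (hr : r ≠ 0) :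
    ∃ C : Set T, C.Finite ∧ IsMinimalCentres r C := by
  obtain ⟨N, -, hfin, hN⟩ :=
    Metric.exists_finite_isCover_of_isCompact hr (isCompact_univ (X := T))
  have h : Metric.coveringNumber r (Set.univ : Set T) ≠ ⊤ :=
    ne_top_of_le_ne_top (Set.encard_ne_top_iff.2 hfin)
      (hN.coveringNumber_le_encard (Set.subset_univ N))
  obtain ⟨C, -, hCfin, hC, hcard⟩ := Metric.exists_set_encard_eq_coveringNumber h
  exact ⟨C, hCfin, hC, hcard⟩

/-- The upper Minkowski (box counting) dimension `limsup_{r → 0} log N_r / (- log r)`, where `N_r`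
is the least number of closed balls of radius `r` that cover `T`. -/
def upperMinkowskiDim (T : Type u) [MetricSpace T] : EReal :=
  Filter.limsup
    (fun r : ℝ≥0 =>
      ((Real.log ((Metric.coveringNumber r (Set.univ : Set T)).toNat : ℝ) / -Real.log (r : ℝ) : ℝ) :
        EReal))
    (nhdsWithin 0 (Set.Ioi 0))

end Covering

end SpectralTriple

end

open scoped ENNReal NNReal InnerProductSpace ComplexOrder

noncomputable section

namespace SpectralTriple

universe u v w

/-! ### Direct sums of bounded operators as unbounded operators. -/

section SumOp

variable {ι : Type w} {H : ι → Type u} [∀ i, NormedAddCommGroup (H i)]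
  [∀ i, InnerProductSpace ℂ (H i)]

/-! `J` consists of all pairs of distinct points of `C n × (C n ∪ C (n + 1))` at distance at most `K
* r_n`, with `r_n = θ * ρ ^ n` (levels count from `0`), each pair taken in one orientation, for one
large constant `K`.

Every operator involved is explicit on each summand. The square of the Dirac operator is the scalar
`d(x,y)⁻²` there, so the resolvent is diagonal with entries `(1 + d⁻²)⁻¹`; it is compact because
only finitely many pairs are longer than a given `ε`. The commutator with `f` has norm `|f x - f y|
/ d(x,y)` on the summand, so the induced distance is the supremum of `|f s - f t|` over the
continuous `f` that are 1-Lipschitz along the pairs of `J`.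

The function `dist s` gives `d ≤ d_δ`. For the other bound (`norm_sub_le_of_levelPairs`), `s` and
`t` are replaced by nearby centres of a level `n` with `r_n` small against `δ * d(s,t)`. These two
centres form a pair of `J`, and the chains of ever finer centres from them to `s` and `t` cost only
a multiple of `r_n`.

The trace is comparable to the sum of `(1 + d⁻²) ^ (-s/2)` over `J` (`isSummable_pairDirac_iff`).
Level `n` has at most `2 * N_{r_{n+1}} ^ 2` pairs, each of weight at most `(K * r_n) ^ s`; the
square is the source of the factor 2 in the dimension bound (`summable_levelPairs_bound`).
Conversely, in a connected space with two points, every centre of a fine level is an end of a pair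
of length at least `r_n`, so the sum bounds `N_{r_n} * r_n ^ s` (`ncard_mul_rpow_le`). -/

theorem apply_single_eq_single [DecidableEq ι] (D : ∀ i, H i →L[ℂ] H i) (i : ι) (v : H i) :
    (fun j => D j ((lp.single (E := H) 2 i v : lp H 2) j)) =
      (lp.single (E := H) 2 i (D i v) : lp H 2) := by
  ext j
  rcases eq_or_ne j i with rfl | h
  · rw [lp.single_apply_self, lp.single_apply_self]
  · rw [lp.single_apply_ne _ _ _ h, lp.single_apply_ne _ _ _ h, map_zero]

theorem single_mem_sumOp_domain [DecidableEq ι] (D : ∀ i, H i →L[ℂ] H i) (i : ι) (v : H i) :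
    (lp.single (E := H) 2 i v : lp H 2) ∈ (sumOp D).domain := by
  change Memℓp (fun j => D j ((lp.single (E := H) 2 i v : lp H 2) j)) 2
  rw [apply_single_eq_single]
  exact lp.memℓp _

theorem sumOp_single [DecidableEq ι] (D : ∀ i, H i →L[ℂ] H i) (i : ι) (v : H i) :
    sumOp D ⟨lp.single (E := H) 2 i v, single_mem_sumOp_domain D i v⟩ =
      lp.single (E := H) 2 i (D i v) :=
  Subtype.ext (apply_single_eq_single D i v)

theorem dense_sumOp_domain (D : ∀ i, H i →L[ℂ] H i) :
    Dense ((sumOp D).domain : Set (lp H 2)) := by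
  classical
  intro ξ
  refine mem_closure_of_tendsto (lp.hasSum_single (by norm_num) ξ) (.of_forall fun s => ?_)
  exact Submodule.sum_mem _ fun i _ => single_mem_sumOp_domain D i _

/-- Symmetry is componentwise. Pairing a vector of the adjoint domain with vectors supported on one
summand shows that the adjoint also acts componentwise by `D i`; its value is square-summable, which
is the condition for membership in the maximal domain. -/
theorem isSelfAdjoint_sumOp [∀ i, CompleteSpace (H i)] (D : ∀ i, H i →L[ℂ] H i)
    (hD : ∀ i, IsSelfAdjoint (D i)) :
    IsSelfAdjoint (sumOp D) := by
  classical
  have hdense := dense_sumOp_domain D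
  have hsym : (sumOp D).IsFormalAdjoint (sumOp D) := by
    intro ξ η
    rw [lp.inner_eq_tsum, lp.inner_eq_tsum]
    exact tsum_congr fun i => (hD i).isSymmetric _ _
  rw [LinearPMap.isSelfAdjoint_def]
  refine (LinearPMap.eq_of_le_of_domain_eq (hsym.le_adjoint hdense) ?_).symm
  refine le_antisymm (hsym.le_adjoint hdense).1 fun ξ hξ => ?_
  have key : ∀ i, D i (ξ i) = ((sumOp D).adjoint ⟨ξ, hξ⟩ : lp H 2) i := by
    intro i
    refine ext_inner_right ℂ fun v => ?_
    have := LinearPMap.adjoint_isFormalAdjoint hdense ⟨ξ, hξ⟩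
      ⟨lp.single (E := H) 2 i v, single_mem_sumOp_domain D i v⟩
    rw [sumOp_single, lp.inner_single_right, lp.inner_single_right] at this
    rw [this]
    exact (hD i).isSymmetric _ _
  change Memℓp (fun i => D i (ξ i)) 2
  rw [funext key]
  exact lp.memℓp _

end SumOp

/-! ### Diagonal operators on a Hilbert sum. -/

section Diagonal

variable {ι : Type w} {H : ι → Type u} [∀ i, NormedAddCommGroup (H i)]
  [∀ i, InnerProductSpace ℂ (H i)]

/-- `R` acts on the summand `H i` as multiplication by the real number `c i`. -/
def IsDiagonal (R : lp H 2 →L[ℂ] lp H 2) (c : ι → ℝ) : Prop :=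
  ∀ (ξ : lp H 2) (i : ι), R ξ i = (c i : ℂ) • ξ i

theorem exists_isDiagonal (c : ι → ℝ) {M : ℝ} (hM : ∀ i, |c i| ≤ M) :
    ∃ R : lp H 2 →L[ℂ] lp H 2, IsDiagonal R c := by
  have hb : ∀ (ξ : lp H 2) i, ‖(c i : ℂ) • ξ i‖ ≤ M * ‖ξ i‖ := fun ξ i => by
    rw [norm_smul, Complex.norm_real, Real.norm_eq_abs]
    gcongr
    exact hM i
  have hmem : ∀ ξ : lp H 2, Memℓp (fun i => (c i : ℂ) • ξ i) 2 := fun ξ =>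
    Memℓp.mono (g := fun i => M * ‖ξ i‖) (((lp.memℓp ξ).norm).const_mul M) (hb ξ)
  refine ⟨LinearMap.mkContinuous
    { toFun := fun ξ => ⟨fun i => (c i : ℂ) • ξ i, hmem ξ⟩
      map_add' := fun ξ η => by ext i : 2; exact smul_add _ _ _
      map_smul' := fun a ξ => by ext i : 2; exact smul_comm _ _ _ } |M| fun ξ => ?_,
    fun ξ i => rfl⟩
  have h : ‖(⟨fun i => (c i : ℂ) • ξ i, hmem ξ⟩ : lp H 2)‖ ≤ ‖(((|M| : ℝ) : ℂ) • ξ : lp H 2)‖ := by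
    refine lp.norm_mono (by norm_num) fun i => (hb ξ i).trans ?_
    rw [lp.coeFn_smul, Pi.smul_apply, norm_smul, Complex.norm_real, Real.norm_eq_abs, abs_abs]
    gcongr
    exact le_abs_self M
  rwa [norm_smul, Complex.norm_real, Real.norm_eq_abs, abs_abs] at h

namespace IsDiagonal

variable {R S : lp H 2 →L[ℂ] lp H 2} {c d : ι → ℝ}

theorem sub (hR : IsDiagonal R c) (hS : IsDiagonal S d) :
    IsDiagonal (R - S) fun i => c i - d i := fun ξ i => by
  have : (R - S) ξ i = R ξ i - S ξ i := rfl
  rw [this, hR, hS]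
  push_cast
  rw [sub_smul]

theorem norm_le (hR : IsDiagonal R c) {M : ℝ} (hM0 : 0 ≤ M) (hM : ∀ i, |c i| ≤ M) : ‖R‖ ≤ M := by
  refine R.opNorm_le_bound hM0 fun ξ => ?_
  have h : ‖R ξ‖ ≤ ‖((M : ℂ) • ξ : lp H 2)‖ := by
    refine lp.norm_mono (by norm_num) fun i => ?_
    rw [hR, lp.coeFn_smul, Pi.smul_apply, norm_smul, norm_smul, Complex.norm_real,
      Complex.norm_real, Real.norm_eq_abs, Real.norm_of_nonneg hM0]
    gcongr
    exact hM i
  rwa [norm_smul, Complex.norm_real, Real.norm_of_nonneg hM0] at h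

theorem apply_single [DecidableEq ι] (hR : IsDiagonal R c) (i : ι) (v : H i) :
    R (lp.single (E := H) 2 i v) = (c i : ℂ) • (lp.single (E := H) 2 i v : lp H 2) := by
  ext j
  rw [hR, lp.coeFn_smul, Pi.smul_apply]
  rcases eq_or_ne j i with rfl | h
  · rfl
  · rw [lp.single_apply_ne _ _ _ h, smul_zero, smul_zero]

/-- The truncations to finite index sets have finite rank, and the norm of the remainder is at most
the supremum of `|c i|` off the set. -/
theorem isCompactOperator [∀ i, FiniteDimensional ℂ (H i)] [∀ i, CompleteSpace (H i)]
    (hR : IsDiagonal R c) (hc : Filter.Tendsto c Filter.cofinite (nhds 0)) :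
    IsCompactOperator R := by
  classical
  let F : Finset ι → (lp H 2 →L[ℂ] lp H 2) := fun s =>
    ∑ i ∈ s, ((c i : ℂ) • (lp.singleContinuousLinearMap ℂ H 2 i)).comp (lp.evalCLM ℂ H 2 i)
  have hF : ∀ s, IsDiagonal (F s) fun i => if i ∈ s then c i else 0 := by
    intro s ξ i
    have : F s ξ i = ∑ j ∈ s, (((c j : ℂ) • lp.single (E := H) 2 j (ξ j) : lp H 2) i) := by
      simp only [F, sum_apply]
      exact map_sum (lp.evalCLM ℂ H 2 i) _ _
    rw [this]
    by_cases hi : i ∈ s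
    · rw [Finset.sum_eq_single i]
      · rw [lp.coeFn_smul, Pi.smul_apply, lp.single_apply_self]
        simp only [hi, if_true]
      · intro j _ hj
        rw [lp.coeFn_smul, Pi.smul_apply, lp.single_apply_ne _ _ _ hj.symm, smul_zero]
      · exact fun h => absurd hi h
    · rw [Finset.sum_eq_zero]
      · simp [hi]
      · intro j hj
        have : i ≠ j := fun h => hi (h ▸ hj)
        rw [lp.coeFn_smul, Pi.smul_apply, lp.single_apply_ne _ _ _ this, smul_zero]
  have hcomp : ∀ s, IsCompactOperator (F s) := fun s => by
    refine Submodule.sum_mem (compactOperator (RingHom.id ℂ) (lp H 2) (lp H 2)) fun i _ => ?_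
    have : ProperSpace (H i) := FiniteDimensional.proper ℂ (H i)
    exact (isCompactOperator_of_locallyCompactSpace_dom (lp.evalCLM ℂ H 2 i)).clm_comp
      ((c i : ℂ) • (lp.singleContinuousLinearMap ℂ H 2 i))
  refine isCompactOperator_of_tendsto (l := Filter.atTop) (F := F) ?_ (.of_forall hcomp)
  rw [Metric.tendsto_atTop]
  intro ε hε
  have hfin : {i | ¬ |c i| < ε / 2}.Finite := by
    have := hc.eventually (Metric.ball_mem_nhds 0 (half_pos hε))
    simpa [Filter.eventually_cofinite, Real.dist_eq] using this
  refine ⟨hfin.toFinset, fun s hs => ?_⟩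
  rw [dist_eq_norm]
  refine lt_of_le_of_lt (((hF s).sub hR).norm_le (M := ε / 2) (half_pos hε).le fun i => ?_)
    (half_lt_self hε)
  by_cases hi : i ∈ s
  · simp [hi, (half_pos hε).le]
  · have : |c i| < ε / 2 := by
      by_contra h
      exact hi (hs (by simpa using h))
    simpa [hi] using this.le

end IsDiagonal

end Diagonal

/-! ### Functional calculus on eigenvectors. -/

section Eigenvector

variable {H : Type u} [NormedAddCommGroup H] [InnerProductSpace ℂ H]

theorem mem_spectrum_real_of_eigenvector {R : H →L[ℂ] H} {x : ℝ} {v : H} (hv : v ≠ 0)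
    (h : R v = (x : ℂ) • v) : x ∈ spectrum ℝ R := by
  rw [spectrum.mem_iff]
  rintro ⟨a, ha⟩
  apply hv
  have h0 : (a : H →L[ℂ] H) v = 0 := by
    rw [ha, sub_apply, h, Algebra.algebraMap_eq_smul_one]
    simp
  have h1 : ((↑a⁻¹ : H →L[ℂ] H) * (a : H →L[ℂ] H)) v = v := by simp
  rw [← h1, mul_apply_eq_comp, h0, map_zero]

variable [CompleteSpace H]

/-- The functions for which this holds form a closed subalgebra that contains the identity, hence
are all the continuous functions on the spectrum. -/
theorem cfc_apply_of_eigenvector {R : H →L[ℂ] H} (hR : IsSelfAdjoint R) {x : ℝ} {v : H}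
    (h : R v = (x : ℂ) • v) {f : ℝ → ℝ} (hf : ContinuousOn f (spectrum ℝ R)) :
    cfc f R v = (f x : ℂ) • v := by
  rcases eq_or_ne v 0 with rfl | hv
  · simp
  have hx := mem_spectrum_real_of_eigenvector hv h
  suffices ∀ g : C(spectrum ℝ R, ℝ), cfcHom hR g v = ((g ⟨x, hx⟩ : ℝ) : ℂ) • v by
    rw [cfc_apply f R hR hf, this]
    rfl
  intro g
  induction g using ContinuousMap.induction_on_of_compact with
  | const r =>
    have : ContinuousMap.const (spectrum ℝ R) r = algebraMap ℝ C(spectrum ℝ R, ℝ) r := rfl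
    rw [this, AlgHomClass.commutes, Algebra.algebraMap_eq_smul_one]
    simp
  | id => rw [cfcHom_id hR, h]; rfl
  | star_id => rw [map_star, cfcHom_id hR, hR.star_eq, h]; rfl
  | add f g hf hg =>
    rw [map_add, add_apply, hf, hg, ← add_smul]
    simp
  | mul f g hf hg =>
    rw [map_mul, mul_apply_eq_comp, hg, map_smul, hf, smul_smul]
    simp [mul_comm]
  | frequently f hf =>
    have hc := cfcHom_continuous (R := ℝ) hR
    exact hf.mem_of_closed <| isClosed_eq (by fun_prop) (by fun_prop)

/-- The real power `R ^ p` in the continuous functional calculus. On a Hilbert sum the notation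
`R ^ p` does not elaborate directly, because the real structure of `lp` interferes. -/
def opRpow (R : H →L[ℂ] H) (p : ℝ) : H →L[ℂ] H :=
  R ^ p

theorem opRpow_apply_of_eigenvector {R : H →L[ℂ] H} (hR : 0 ≤ R) {x p : ℝ} (hp : 0 ≤ p) {v : H}
    (h : R v = (x : ℂ) • v) : opRpow R p v = ((x ^ p : ℝ) : ℂ) • v := by
  rw [opRpow, CFC.rpow_eq_cfc_real hR]
  exact cfc_apply_of_eigenvector (IsSelfAdjoint.of_nonneg hR) h
    (Real.continuous_rpow_const hp).continuousOn

theorem isSymmetric_opRpow (R : H →L[ℂ] H) (p : ℝ) :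
    LinearMap.IsSymmetric (opRpow R p : H →ₗ[ℂ] H) :=
  (IsSelfAdjoint.of_nonneg (CFC.rpow_nonneg (a := R) (y := p))).isSymmetric

end Eigenvector

/-! ### Positivity and powers of diagonal operators. -/

section Diagonal

variable {ι : Type w} {H : ι → Type u} [∀ i, NormedAddCommGroup (H i)]
  [∀ i, InnerProductSpace ℂ (H i)]
  {R : lp H 2 →L[ℂ] lp H 2} {c : ι → ℝ}

namespace IsDiagonal

theorem hasSum_inner (hR : IsDiagonal R c) (ξ : lp H 2) :
    HasSum (fun i => c i * ‖ξ i‖ ^ 2) (⟪ξ, R ξ⟫_ℂ).re := by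
  refine (Complex.hasSum_re (lp.hasSum_inner ξ (R ξ))).congr_fun fun i => ?_
  rw [hR, inner_smul_right, Complex.re_ofReal_mul]
  congr 1
  exact norm_sq_eq_re_inner (𝕜 := ℂ) (ξ i)

variable [∀ i, CompleteSpace (H i)]

theorem isSelfAdjoint (hR : IsDiagonal R c) : IsSelfAdjoint R := by
  rw [ContinuousLinearMap.isSelfAdjoint_iff_isSymmetric]
  intro ξ η
  change ⟪R ξ, η⟫_ℂ = ⟪ξ, R η⟫_ℂ
  rw [lp.inner_eq_tsum, lp.inner_eq_tsum]
  refine tsum_congr fun i => ?_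
  rw [hR, hR, inner_smul_right, inner_smul_left, Complex.conj_ofReal]

theorem nonneg (hR : IsDiagonal R c) (hc : ∀ i, 0 ≤ c i) : 0 ≤ R := by
  rw [ContinuousLinearMap.nonneg_iff_isPositive, ContinuousLinearMap.isPositive_def']
  refine ⟨hR.isSelfAdjoint, fun ξ => ?_⟩
  have := (hR.hasSum_inner ξ).nonneg fun i => mul_nonneg (hc i) (sq_nonneg _)
  rw [ContinuousLinearMap.reApplyInnerSelf_apply, inner_re_symm]
  exact this

/-- Vectors supported on one summand are eigenvectors of `R`, hence of its power; symmetry of the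
power carries this over to the components of an arbitrary vector. -/
theorem rpow (hR : IsDiagonal R c) (hc : ∀ i, 0 ≤ c i) {p : ℝ} (hp : 0 ≤ p) :
    IsDiagonal (opRpow R p) fun i => c i ^ p := by
  classical
  have hsymm := isSymmetric_opRpow R p
  have hsingle : ∀ i v, opRpow R p (lp.single (E := H) 2 i v) =
      ((c i ^ p : ℝ) : ℂ) • (lp.single (E := H) 2 i v : lp H 2) := fun i v =>
    opRpow_apply_of_eigenvector (hR.nonneg hc) hp (hR.apply_single i v)
  intro ξ i
  refine ext_inner_left ℂ fun v => ?_
  have := hsymm (lp.single (E := H) 2 i v) ξ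
  change ⟪opRpow R p (lp.single (E := H) 2 i v), ξ⟫_ℂ = ⟪_, opRpow R p ξ⟫_ℂ at this
  rw [hsingle, lp.inner_single_left, inner_smul_left, lp.inner_single_left,
    Complex.conj_ofReal] at this
  rw [← this, inner_smul_right]

end IsDiagonal

end Diagonal

/-! ### The resolvent of a direct sum. -/

section Resolvent

theorem IsInvOneAddSq.unique {H : Type u} [NormedAddCommGroup H] [InnerProductSpace ℂ H]
    [CompleteSpace H] {D : H →ₗ.[ℂ] H} {R S : H →L[ℂ] H} (hR : IsInvOneAddSq D R)
    (hS : IsInvOneAddSq D S) : R = S := by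
  ext η
  exact ((hS (R η) η).2 ((hR (R η) η).1 rfl)).symm

theorem isSummable_iff {H : Type u} [NormedAddCommGroup H] [InnerProductSpace ℂ H]
    [CompleteSpace H] {D : H →ₗ.[ℂ] H} {R : H →L[ℂ] H} (hR : IsInvOneAddSq D R) {s : ℝ}
    (hs : 0 < s) : IsSummable D s ↔ HasFiniteTrace (opRpow R (s / 2)) := by
  constructor
  · rintro ⟨-, S, hS, h⟩
    obtain rfl := hS.unique hR
    exact h
  · exact fun h => ⟨hs, R, hR, h⟩

variable {ι : Type w} {H : ι → Type u} [∀ i, NormedAddCommGroup (H i)]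
  [∀ i, InnerProductSpace ℂ (H i)] [∀ i, CompleteSpace (H i)]

theorem IsDiagonal.isInvOneAddSq_sumOp {R : lp H 2 →L[ℂ] lp H 2} {D : ∀ i, H i →L[ℂ] H i}
    {μ : ι → ℝ} (hμ : ∀ i, 0 ≤ μ i) (hD : ∀ i, IsSelfAdjoint (D i))
    (hsq : ∀ i v, D i (D i v) = (μ i : ℂ) • v) (hR : IsDiagonal R fun i => (1 + μ i)⁻¹) :
    IsInvOneAddSq (sumOp D) R := by
  have hpos : ∀ i, 0 < 1 + μ i := fun i => by linarith [hμ i]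
  have hne : ∀ i, (1 + μ i : ℂ) ≠ 0 := fun i => by exact_mod_cast (hpos i).ne'
  intro ξ η
  constructor
  · intro h
    have hcomp : ∀ i, ξ i = (((1 + μ i)⁻¹ : ℝ) : ℂ) • η i := fun i => by rw [← h, hR]
    have hnorm : ∀ i, ‖D i (ξ i)‖ ≤ ‖η i‖ := fun i => by
      have h1 : ‖D i (η i)‖ ^ 2 = μ i * ‖η i‖ ^ 2 := by
        have : ⟪D i (η i), D i (η i)⟫_ℂ = ⟪η i, D i (D i (η i))⟫_ℂ :=
          (hD i).isSymmetric _ _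
        rw [norm_sq_eq_re_inner (𝕜 := ℂ), this, hsq, inner_smul_right,
          norm_sq_eq_re_inner (𝕜 := ℂ) (η i)]
        exact Complex.re_ofReal_mul _ _
      rw [hcomp, map_smul, norm_smul, Complex.norm_real,
        Real.norm_of_nonneg (by positivity [hpos i])]
      rw [inv_mul_le_iff₀ (hpos i)]
      -- Since `μ ≤ (1 + μ) ^ 2`, the operator `D (1 + D²)⁻¹` is a contraction on each summand.
      refine abs_le_of_sq_le_sq' ?_ (by have := hpos i; positivity) |>.2
      rw [h1, mul_pow]
      gcongr
      nlinarith [hμ i]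
    have h₁ : ξ ∈ (sumOp D).domain := Memℓp.mono (g := fun i => ‖η i‖) (lp.memℓp η).norm hnorm
    have hDD : ∀ i, D i (D i (ξ i)) = η i - ξ i := fun i => by
      rw [hsq, hcomp, smul_smul]
      nth_rw 2 [← one_smul ℂ (η i)]
      rw [← sub_smul]
      congr 1
      push_cast
      field_simp [hne i]
      ring
    have h₂ : sumOp D ⟨ξ, h₁⟩ ∈ (sumOp D).domain := by
      change Memℓp (fun i => D i (D i (ξ i))) 2
      simp_rw [hDD]
      exact lp.memℓp (η - ξ)
    refine ⟨h₁, h₂, ?_⟩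
    ext i
    change ξ i + D i (D i (ξ i)) = η i
    rw [hDD, add_sub_cancel]
  · rintro ⟨h₁, h₂, h⟩
    ext i
    have : ξ i + D i (D i (ξ i)) = η i := by rw [← h]; rfl
    rw [hR, ← this, hsq]
    nth_rw 1 [← one_smul ℂ (ξ i)]
    rw [← add_smul, smul_smul]
    push_cast
    rw [inv_mul_cancel₀ (hne i), one_smul]

end Resolvent

/-! ### Traces of diagonal operators. -/

section Trace

/-- By Bessel's inequality, applied to the `m` coordinate vectors of a summand, the components of
any orthonormal family there have squared norms of sum at most `m`. Thus the trace in any basis is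
at most `m * ∑ c i`. -/
theorem IsDiagonal.hasFiniteTrace {ι : Type u} {m : ℕ}
    {P : lp (fun _ : ι => EuclideanSpace ℂ (Fin m)) 2 →L[ℂ]
      lp (fun _ : ι => EuclideanSpace ℂ (Fin m)) 2} {c : ι → ℝ} (hP : IsDiagonal P c)
    (hc : ∀ i, 0 ≤ c i) (hsum : Summable c) : HasFiniteTrace P := by
  classical
  intro κ e
  have hterm : ∀ i (F : Finset κ), ∑ k ∈ F, ‖(e k) i‖ ^ 2 ≤ m := fun i F => by
    have hcoord : ∀ k (j : Fin m), ‖(e k) i j‖ ^ 2 =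
        ‖⟪e k, lp.single (E := fun _ : ι => EuclideanSpace ℂ (Fin m)) 2 i
          (EuclideanSpace.single j 1)⟫_ℂ‖ ^ 2 := fun k j => by
      rw [lp.inner_single_right, EuclideanSpace.inner_single_right]
      simp
    calc ∑ k ∈ F, ‖(e k) i‖ ^ 2 = ∑ j : Fin m, ∑ k ∈ F, ‖(e k) i j‖ ^ 2 := by
          rw [Finset.sum_comm]
          exact Finset.sum_congr rfl fun k _ => EuclideanSpace.norm_sq_eq _
      _ ≤ ∑ j : Fin m, 1 := by
          refine Finset.sum_le_sum fun j _ => ?_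
          simp_rw [hcoord]
          refine (e.orthonormal.sum_inner_products_le _).trans ?_
          rw [lp.norm_single (by norm_num)]
          simp
      _ = m := by simp
  refine summable_of_sum_le (c := ∑' i, c i * m) (fun k => ?_) fun F => ?_
  · exact (hP.hasSum_inner (e k)).nonneg fun i => mul_nonneg (hc i) (sq_nonneg _)
  · refine hasSum_le (fun i => ?_) (hasSum_sum fun k _ => hP.hasSum_inner (e k))
      (hsum.mul_right (m : ℝ)).hasSum
    rw [← Finset.mul_sum]
    exact mul_le_mul_of_nonneg_left (hterm i F) (hc i)

/-- One unit vector per summand gives an orthonormal family with diagonal entries `c i`; it extends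
to a Hilbert basis, in which the trace converges. -/
theorem IsDiagonal.summable_of_hasFiniteTrace {ι : Type u} {H : ι → Type}
    [∀ i, NormedAddCommGroup (H i)] [∀ i, InnerProductSpace ℂ (H i)] [∀ i, CompleteSpace (H i)]
    {P : lp H 2 →L[ℂ] lp H 2} {c : ι → ℝ} (hP : IsDiagonal P c) (h : HasFiniteTrace P)
    (u : ∀ i, H i) (hu : ∀ i, ‖u i‖ = 1) : Summable c := by
  classical
  let v : ι → lp H 2 := fun i => lp.single 2 i (u i)
  have hv : Orthonormal ℂ v := by
    rw [orthonormal_iff_ite]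
    intro i j
    rw [lp.inner_single_left]
    split_ifs with hij
    · subst hij
      rw [lp.single_apply_self, inner_self_eq_norm_sq_to_K, hu]
      simp
    · rw [lp.single_apply_ne _ _ _ hij, inner_zero_right]
  obtain ⟨w, b, hw, hb⟩ := hv.toSubtypeRange.exists_hilbertBasis_extension
  let g : ι → w := fun i => ⟨v i, hw ⟨i, rfl⟩⟩
  have hg : Function.Injective g := fun i j hij =>
    hv.linearIndependent.injective (congrArg Subtype.val hij)
  refine ((h w b).comp_injective hg).congr fun i => ?_
  have : b (g i) = v i := by rw [hb]
  rw [Function.comp_apply, this, hP.apply_single, inner_smul_right, lp.inner_single_left,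
    lp.single_apply_self, inner_self_eq_norm_sq_to_K, hu]
  simp

end Trace

/-! ### Density of Lipschitz functions. -/

section LipschitzDense

variable {T : Type u} [MetricSpace T]

/-- The function `x ↦ dist s x`. -/
def distMap (s : T) : C(T, ℂ) where
  toFun x := ((dist s x : ℝ) : ℂ)

theorem norm_distMap_sub_le (s x y : T) : ‖distMap s x - distMap s y‖ ≤ dist x y := by
  have : distMap s x - distMap s y = ((dist s x - dist s y : ℝ) : ℂ) := by
    simp [distMap]
  rw [this, Complex.norm_real, Real.norm_eq_abs, dist_comm s x, dist_comm s y]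
  exact abs_dist_sub_le x y s

theorem norm_distMap_sub_self (s t : T) : ‖distMap s s - distMap s t‖ = dist s t := by
  simp [distMap]

variable [CompactSpace T]

/-- The star subalgebra of Lipschitz functions. -/
def lipschitzSubalgebra (T : Type u) [MetricSpace T] [CompactSpace T] :
    StarSubalgebra ℂ C(T, ℂ) where
  carrier := {f | ∃ c : ℝ, ∀ x y, ‖f x - f y‖ ≤ c * dist x y}
  mul_mem' := by
    rintro f g ⟨a, ha⟩ ⟨b, hb⟩
    refine ⟨‖f‖ * b + a * ‖g‖, fun x y => ?_⟩
    have h : (f * g) x - (f * g) y = f x * (g x - g y) + (f x - f y) * g y := by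
      simp only [ContinuousMap.mul_apply]; ring
    rw [h]
    refine (norm_add_le _ _).trans ?_
    rw [norm_mul, norm_mul]
    have h1 : ‖f x‖ * ‖g x - g y‖ ≤ ‖f‖ * (b * dist x y) :=
      mul_le_mul (f.norm_coe_le_norm x) (hb x y) (norm_nonneg _) (norm_nonneg _)
    have h2 : ‖f x - f y‖ * ‖g y‖ ≤ (a * dist x y) * ‖g‖ :=
      mul_le_mul (ha x y) (g.norm_coe_le_norm y) (norm_nonneg _) ((norm_nonneg _).trans (ha x y))
    linarith
  add_mem' := by
    rintro f g ⟨a, ha⟩ ⟨b, hb⟩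
    refine ⟨a + b, fun x y => ?_⟩
    have h : (f + g) x - (f + g) y = (f x - f y) + (g x - g y) := by
      simp only [ContinuousMap.add_apply]; ring
    rw [h, add_mul]
    exact (norm_add_le _ _).trans (add_le_add (ha x y) (hb x y))
  algebraMap_mem' c := ⟨0, fun x y => by simp⟩
  star_mem' := by
    rintro f ⟨a, ha⟩
    refine ⟨a, fun x y => ?_⟩
    rw [ContinuousMap.star_apply, ContinuousMap.star_apply, ← star_sub, norm_star]
    exact ha x y

/-- Stone–Weierstrass: the distance functions are Lipschitz and separate points. -/
theorem dense_lipschitz :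
    Dense {f : C(T, ℂ) | ∃ c : ℝ, ∀ x y, ‖f x - f y‖ ≤ c * dist x y} := by
  have h := ContinuousMap.starSubalgebra_topologicalClosure_eq_top_of_separatesPoints
    (lipschitzSubalgebra T) (fun x y hxy => ⟨distMap x, ⟨distMap x, ⟨1, fun a b => by
      rw [one_mul]; exact norm_distMap_sub_le x a b⟩, rfl⟩, fun h => hxy ?_⟩)
  · intro f
    have hf : f ∈ (lipschitzSubalgebra T).topologicalClosure := h ▸ StarSubalgebra.mem_top
    exact hf
  · rw [← dist_eq_zero, ← norm_distMap_sub_self, h, sub_self, norm_zero]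

end LipschitzDense

/-! ### The two-point triple. -/

section TwoPointTriple

variable {T : Type u} [MetricSpace T]

theorem twoPointDirac_apply (x y : T) (v : EuclideanSpace ℂ (Fin 2)) :
    twoPointDirac x y v =
      !₂[((dist x y : ℝ) : ℂ)⁻¹ * v 1, ((dist x y : ℝ) : ℂ)⁻¹ * v 0] := by
  ext i
  fin_cases i <;> simp [twoPointDirac, Matrix.vecHead, Matrix.vecTail]

theorem isSelfAdjoint_twoPointDirac (x y : T) : IsSelfAdjoint (twoPointDirac x y) := by
  rw [IsSelfAdjoint, twoPointDirac, ← map_star]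
  congr 1
  ext i j
  fin_cases i <;> fin_cases j <;> simp

theorem twoPointDirac_sq (x y : T) (v : EuclideanSpace ℂ (Fin 2)) :
    twoPointDirac x y (twoPointDirac x y v) = (((dist x y ^ 2)⁻¹ : ℝ) : ℂ) • v := by
  rw [twoPointDirac_apply, twoPointDirac_apply]
  ext i
  fin_cases i <;> simp <;> ring

theorem twoPointRep_apply [CompactSpace T] (x y : T) (f : C(T, ℂ)) (v : EuclideanSpace ℂ (Fin 2)) :
    twoPointRep x y f v = !₂[f x * v 0, f y * v 1] := by
  ext i
  fin_cases i <;> simp [twoPointRep, Matrix.mulVec_diagonal]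

/-- The commutator sends `(α, β)` to `(f y - f x) / d(x,y)` times `(β, -α)`, a multiple of an
isometry. -/
theorem norm_twoPoint_commutator [CompactSpace T] (x y : T) (f : C(T, ℂ))
    (v : EuclideanSpace ℂ (Fin 2)) :
    ‖twoPointDirac x y (twoPointRep x y f v) - twoPointRep x y f (twoPointDirac x y v)‖ =
      ‖f x - f y‖ * (dist x y)⁻¹ * ‖v‖ := by
  rw [← sq_eq_sq₀ (norm_nonneg _) (by positivity), mul_pow, mul_pow, EuclideanSpace.norm_sq_eq,
    EuclideanSpace.norm_sq_eq, Fin.sum_univ_two, Fin.sum_univ_two]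
  simp only [twoPointDirac_apply, twoPointRep_apply]
  have h0 : ∀ a b c d : ℂ, d * (a * b) - c * (d * b) = (a - c) * (d * b) := by intros; ring
  simp [h0, mul_pow, norm_sub_rev (f y) (f x)]
  ring

end TwoPointTriple

/-! ### The sum of the two-point triples over `J`. -/

section Pairs

variable {T : Type u} [MetricSpace T] {J : Set (T × T)}

theorem isSelfAdjoint_pairDirac : IsSelfAdjoint (pairDirac J) :=
  isSelfAdjoint_sumOp _ fun _ => isSelfAdjoint_twoPointDirac _ _

theorem exists_isInvOneAddSq_pairDirac (J : Set (T × T)) : ∃ R : PairSpace J →L[ℂ] PairSpace J,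
    IsDiagonal R (fun p : J => (1 + (dist p.1.1 p.1.2 ^ 2)⁻¹)⁻¹) ∧
      IsInvOneAddSq (pairDirac J) R := by
  obtain ⟨R, hR⟩ := exists_isDiagonal (H := fun _ : J => EuclideanSpace ℂ (Fin 2))
    (fun p : J => (1 + (dist p.1.1 p.1.2 ^ 2)⁻¹)⁻¹) (M := 1) fun p => by
      rw [abs_of_nonneg (by positivity)]
      exact inv_le_one_of_one_le₀ (le_add_of_nonneg_right (by positivity))
  exact ⟨R, hR, hR.isInvOneAddSq_sumOp (fun _ => by positivity)
    (fun _ => isSelfAdjoint_twoPointDirac _ _) fun _ _ => twoPointDirac_sq _ _ _⟩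

/-- The trace of `(I + D²) ^ (-s / 2)` for the Dirac operator of the pairs in `J` is finite if and
only if the corresponding sum over `J` is. -/
theorem isSummable_pairDirac_iff {s : ℝ} (hs : 0 < s) : IsSummable (pairDirac J) s ↔
    Summable fun p : J => ((1 + (dist p.1.1 p.1.2 ^ 2)⁻¹)⁻¹ : ℝ) ^ (s / 2) := by
  obtain ⟨R, hR, hinv⟩ := exists_isInvOneAddSq_pairDirac J
  have hw : ∀ p : J, 0 ≤ (1 + (dist p.1.1 p.1.2 ^ 2)⁻¹)⁻¹ := fun p => by positivity
  have hdiag := hR.rpow hw (half_pos hs).le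
  refine (isSummable_iff hinv hs).trans ⟨fun h => ?_, fun h => ?_⟩
  · have hu : ∀ p : J, ‖(EuclideanSpace.single 0 1 : EuclideanSpace ℂ (Fin 2))‖ = 1 := by simp
    exact hdiag.summable_of_hasFiniteTrace h _ hu
  · have hw' : ∀ p : J, 0 ≤ ((1 + (dist p.1.1 p.1.2 ^ 2)⁻¹)⁻¹) ^ (s / 2) := fun p =>
      Real.rpow_nonneg (hw p) _
    exact hdiag.hasFiniteTrace hw' h

variable [CompactSpace T]

theorem commutatorNormLE_pair_of_le {f : C(T, ℂ)} {c : ℝ} (hJ : ∀ p ∈ J, p.1 ≠ p.2)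
    (hc : 0 ≤ c) (h : ∀ p ∈ J, ‖f p.1 - f p.2‖ ≤ c * dist p.1 p.2) :
    CommutatorNormLE (pairRep J) (pairDirac J) f c := by
  have hb : ∀ (p : J) (v : EuclideanSpace ℂ (Fin 2)),
      ‖twoPointDirac p.1.1 p.1.2 (twoPointRep p.1.1 p.1.2 f v) -
        twoPointRep p.1.1 p.1.2 f (twoPointDirac p.1.1 p.1.2 v)‖ ≤ c * ‖v‖ := fun p v => by
    rw [norm_twoPoint_commutator]
    gcongr
    have := dist_pos.2 (hJ p.1 p.2)
    rw [← div_eq_mul_inv, div_le_iff₀ this]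
    exact h p.1 p.2
  intro ξ
  have hmem : Memℓp (fun p : J => twoPointDirac p.1.1 p.1.2
      (twoPointRep p.1.1 p.1.2 f ((ξ : PairSpace J) p))) 2 := by
    -- `D π(f) ξ = [D, π(f)] ξ + π(f) D ξ` on each summand, and both terms are square-summable.
    have h1 : Memℓp (fun p : J => twoPointDirac p.1.1 p.1.2
        (twoPointRep p.1.1 p.1.2 f ((ξ : PairSpace J) p)) -
        twoPointRep p.1.1 p.1.2 f (twoPointDirac p.1.1 p.1.2 ((ξ : PairSpace J) p))) 2 :=
      Memℓp.mono (g := fun p => c * ‖(ξ : PairSpace J) p‖)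
        (((lp.memℓp (ξ : PairSpace J)).norm).const_mul c) fun p => hb p _
    have h2 := h1.add (lp.memℓp (pairRep J f (pairDirac J ξ)))
    convert! h2 using 1
    funext p
    exact (sub_add_cancel _ _).symm
  refine ⟨hmem, ?_⟩
  have h : ‖pairDirac J ⟨pairRep J f (ξ : PairSpace J), hmem⟩ - pairRep J f (pairDirac J ξ)‖ ≤
      ‖((c : ℂ) • (ξ : PairSpace J) : PairSpace J)‖ := by
    refine lp.norm_mono (by norm_num) fun p => ?_
    rw [lp.coeFn_smul, Pi.smul_apply, norm_smul, Complex.norm_real, Real.norm_of_nonneg hc]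
    exact hb p _
  rwa [norm_smul, Complex.norm_real, Real.norm_of_nonneg hc] at h

/-- The commutator is tested on a unit vector in the summand of `p`. -/
theorem norm_sub_le_of_commutatorNormLE {f : C(T, ℂ)} {c : ℝ}
    (h : CommutatorNormLE (pairRep J) (pairDirac J) f c) {p : T × T} (hp : p ∈ J)
    (hne : p.1 ≠ p.2) : ‖f p.1 - f p.2‖ ≤ c * dist p.1 p.2 := by
  classical
  let v : EuclideanSpace ℂ (Fin 2) := EuclideanSpace.single 0 1
  have hv : ‖v‖ = 1 := by simp [v]
  let e : PairSpace J := lp.single 2 ⟨p, hp⟩ v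
  have he : ‖e‖ = 1 := by rw [lp.norm_single (by norm_num), hv]
  have hep : e ⟨p, hp⟩ = v := lp.single_apply_self _ _ _
  obtain ⟨hmem, hle⟩ := h ⟨e, single_mem_sumOp_domain _ _ _⟩
  have h1 := (lp.norm_apply_le_norm (by norm_num) _ ⟨p, hp⟩).trans hle
  change ‖twoPointDirac p.1 p.2 (twoPointRep p.1 p.2 f (e ⟨p, hp⟩)) -
    twoPointRep p.1 p.2 f (twoPointDirac p.1 p.2 (e ⟨p, hp⟩))‖ ≤ c * ‖e‖ at h1
  rw [norm_twoPoint_commutator, hep, hv, he, mul_one, mul_one, ← div_eq_mul_inv,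
    div_le_iff₀ (dist_pos.2 hne)] at h1
  exact h1

/-- The pairs in `J` yield a spectral triple as soon as only finitely many of them are further
apart than any given positive number. -/
theorem isSpectralTriple_pair (hJ : ∀ p ∈ J, p.1 ≠ p.2)
    (hfin : ∀ ε > 0, {p : J | ε ≤ dist p.1.1 p.1.2}.Finite) :
    IsSpectralTriple (pairRep J) (pairDirac J) where
  dense_domain := dense_sumOp_domain _
  selfAdjoint := isSelfAdjoint_pairDirac
  dense_bounded_commutator := dense_lipschitz.mono <| by
    rintro f ⟨c, hc⟩
    exact ⟨|c|, commutatorNormLE_pair_of_le hJ (abs_nonneg c) fun p _ => (hc _ _).trans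
      (mul_le_mul_of_nonneg_right (le_abs_self c) dist_nonneg)⟩
  compact_resolvent := by
    obtain ⟨R, hR, hinv⟩ := exists_isInvOneAddSq_pairDirac J
    refine ⟨R, hinv, hR.isCompactOperator ?_⟩
    have hd : Filter.Tendsto (fun p : J => dist p.1.1 p.1.2) Filter.cofinite (nhds 0) := by
      rw [Metric.tendsto_nhds]
      intro ε hε
      rw [Filter.eventually_cofinite]
      simpa [Real.dist_eq] using hfin ε hε
    -- The entries satisfy `(1 + d⁻²)⁻¹ ≤ d²`.
    refine squeeze_zero (fun p => by positivity) (fun p => ?_)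
      (by simpa using hd.pow 2 : Filter.Tendsto (fun p : J => dist p.1.1 p.1.2 ^ 2) _ (nhds 0))
    have := dist_pos.2 (hJ p.1 p.2)
    rw [inv_le_comm₀ (by positivity) (by positivity)]
    linarith

end Pairs

/-! ### The induced distance between points. -/

section InducedMetric

variable {T : Type u} [MetricSpace T] [CompactSpace T] {J : Set (T × T)}

theorem inducedDist_comm {A : Type v} [CStarAlgebra A] {H : Type u} [NormedAddCommGroup H]
    [InnerProductSpace ℂ H] [CompleteSpace H] (π : A →⋆ₐ[ℂ] (H →L[ℂ] H)) (D : H →ₗ.[ℂ] H)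
    (φ ψ : StateSpace A) : inducedDist π D φ ψ = inducedDist π D ψ φ := by
  simp only [inducedDist]
  exact iSup_congr fun a => iSup_congr fun _ => by rw [← enorm_neg, neg_sub]

theorem inducedDist_triangle {A : Type v} [CStarAlgebra A] {H : Type u} [NormedAddCommGroup H]
    [InnerProductSpace ℂ H] [CompleteSpace H] (π : A →⋆ₐ[ℂ] (H →L[ℂ] H)) (D : H →ₗ.[ℂ] H)
    (φ ψ χ : StateSpace A) :
    inducedDist π D φ χ ≤ inducedDist π D φ ψ + inducedDist π D ψ χ := by
  refine iSup₂_le fun a ha => ?_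
  have h : φ.1 a - χ.1 a = (φ.1 a - ψ.1 a) + (ψ.1 a - χ.1 a) := by ring
  rw [h]
  refine (enorm_add_le _ _).trans (add_le_add ?_ ?_)
  · exact le_iSup₂ (f := fun a (_ : CommutatorNormLE π D a 1) => ‖φ.1 a - ψ.1 a‖ₑ) a ha
  · exact le_iSup₂ (f := fun a (_ : CommutatorNormLE π D a 1) => ‖ψ.1 a - χ.1 a‖ₑ) a ha

theorem ofReal_dist_le_inducedDist (hJ : ∀ p ∈ J, p.1 ≠ p.2) (s t : T) :
    ENNReal.ofReal (dist s t) ≤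
      inducedDist (pairRep J) (pairDirac J) (pointState s) (pointState t) := by
  have h : CommutatorNormLE (pairRep J) (pairDirac J) (distMap s) 1 :=
    commutatorNormLE_pair_of_le hJ zero_le_one fun p _ => by
      rw [one_mul]; exact norm_distMap_sub_le s _ _
  refine le_trans (le_of_eq ?_) (le_iSup₂ (f := fun a (_ : CommutatorNormLE (pairRep J)
    (pairDirac J) a 1) => ‖(pointState s).1 a - (pointState t).1 a‖ₑ) (distMap s) h)
  change _ = ‖distMap s s - distMap s t‖ₑ
  rw [← ofReal_norm, norm_distMap_sub_self]

theorem inducedDist_le_ofReal (hJ : ∀ p ∈ J, p.1 ≠ p.2) {s t : T} {M : ℝ}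
    (hM : ∀ f : C(T, ℂ), (∀ p ∈ J, ‖f p.1 - f p.2‖ ≤ dist p.1 p.2) → ‖f s - f t‖ ≤ M) :
    inducedDist (pairRep J) (pairDirac J) (pointState s) (pointState t) ≤ ENNReal.ofReal M := by
  refine iSup₂_le fun f hf => ?_
  change ‖f s - f t‖ₑ ≤ _
  rw [← ofReal_norm]
  refine ENNReal.ofReal_le_ofReal (hM f fun p hp => ?_)
  simpa using norm_sub_le_of_commutatorNormLE hf hp (hJ p hp)

/-- Symmetry and the triangle inequality hold for any induced distance; finiteness comes from the
upper bound and separation of points from the lower bound. -/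
theorem exists_metric_of_lipschitz_bound (hJ : ∀ p ∈ J, p.1 ≠ p.2) {M : ℝ} (hM0 : 0 ≤ M)
    (hM : ∀ f : C(T, ℂ), (∀ p ∈ J, ‖f p.1 - f p.2‖ ≤ dist p.1 p.2) →
      ∀ s t, ‖f s - f t‖ ≤ M * dist s t) :
    ∃ dδ : T → T → ℝ,
      (∀ s t, inducedDist (pairRep J) (pairDirac J) (pointState s) (pointState t) =
        ENNReal.ofReal (dδ s t)) ∧
      (∀ s t, dδ s t = 0 ↔ s = t) ∧
      (∀ s t, dδ s t = dδ t s) ∧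
      (∀ r s t, dδ r t ≤ dδ r s + dδ s t) ∧
      ∀ s t, dist s t ≤ dδ s t ∧ dδ s t ≤ M * dist s t := by
  let E : T → T → ℝ≥0∞ := fun s t =>
    inducedDist (pairRep J) (pairDirac J) (pointState s) (pointState t)
  have hup : ∀ s t, E s t ≤ ENNReal.ofReal (M * dist s t) := fun s t =>
    inducedDist_le_ofReal hJ fun f hf => hM f hf s t
  have hfin : ∀ s t, E s t ≠ ⊤ := fun s t => ne_top_of_le_ne_top ENNReal.ofReal_ne_top (hup s t)
  have hbd : ∀ s t, dist s t ≤ (E s t).toReal ∧ (E s t).toReal ≤ M * dist s t := fun s t =>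
    ⟨(ENNReal.ofReal_le_iff_le_toReal (hfin s t)).1 (ofReal_dist_le_inducedDist hJ s t),
      ENNReal.toReal_le_of_le_ofReal (mul_nonneg hM0 dist_nonneg) (hup s t)⟩
  refine ⟨fun s t => (E s t).toReal, fun s t => (ENNReal.ofReal_toReal (hfin s t)).symm,
    fun s t => ⟨fun h => ?_, ?_⟩, fun s t => ?_, fun r s t => ?_, hbd⟩
  · exact dist_le_zero.1 ((hbd s t).1.trans h.le)
  · rintro rfl
    have := hbd s s
    rw [dist_self, mul_zero] at this
    exact le_antisymm this.2 this.1
  · exact congrArg ENNReal.toReal (inducedDist_comm _ _ _ _)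
  · rw [← ENNReal.toReal_add (hfin r s) (hfin s t)]
    exact ENNReal.toReal_mono (ENNReal.add_ne_top.2 ⟨hfin r s, hfin s t⟩)
      (inducedDist_triangle _ _ _ _ _)

end InducedMetric

/-! ### The pairs of each level and the Lipschitz estimate along them. -/

section LevelPairs

/-- From a set of pairs of distinct points one can select one orientation of each pair. -/
theorem exists_orientation {T : Type u} (S : Set (T × T)) (hS : ∀ p ∈ S, p.1 ≠ p.2) :
    ∃ J ⊆ S, (∀ x y, (x, y) ∈ J → (y, x) ∉ J) ∧ ∀ x y, (x, y) ∈ S → (x, y) ∈ J ∨ (y, x) ∈ J := by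
  classical
  let _ : LinearOrder T := linearOrderOfSTO WellOrderingRel
  -- The auxiliary order matters only when `S` contains both orientations; then the increasing one
  -- is kept.
  refine ⟨{p | p ∈ S ∧ (p.swap ∈ S → p.1 < p.2)}, fun p hp => hp.1, fun x y h h' => ?_,
    fun x y h => ?_⟩
  · exact lt_asymm (h.2 h'.1) (h'.2 h.1)
  · by_cases hyx : (y, x) ∈ S
    · rcases lt_or_gt_of_ne (hS _ h) with hlt | hgt
      · exact .inl ⟨h, fun _ => hlt⟩
      · exact .inr ⟨hyx, fun _ => hgt⟩
    · exact .inl ⟨h, fun h' => absurd h' hyx⟩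

variable {T : Type u} [MetricSpace T]

/-- The pairs of distinct points of `C n × (C n ∪ C (n + 1))` at distance at most `R n`. -/
def levelPairs (C : ℕ → Set T) (R : ℕ → ℝ) (n : ℕ) : Set (T × T) :=
  {p | p.1 ≠ p.2 ∧ p.1 ∈ C n ∧ p.2 ∈ C n ∪ C (n + 1) ∧ dist p.1 p.2 ≤ R n}

theorem levelPairs_subset (C : ℕ → Set T) (R : ℕ → ℝ) (n : ℕ) :
    levelPairs C R n ⊆ C n ×ˢ (C n ∪ C (n + 1)) :=
  fun _ h => ⟨h.2.1, h.2.2.1⟩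

theorem finite_levelPairs {C : ℕ → Set T} (hC : ∀ n, (C n).Finite) (R : ℕ → ℝ) (n : ℕ) :
    (levelPairs C R n).Finite :=
  ((hC n).prod ((hC n).union (hC (n + 1)))).subset (levelPairs_subset C R n)

theorem ncard_levelPairs_le {C : ℕ → Set T} (hC : ∀ n, (C n).Finite) (R : ℕ → ℝ) (n : ℕ) :
    (levelPairs C R n).ncard ≤ (C n).ncard * ((C n).ncard + (C (n + 1)).ncard) := by
  refine (Set.ncard_le_ncard (levelPairs_subset C R n)
    ((hC n).prod ((hC n).union (hC (n + 1))))).trans ?_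
  rw [Set.ncard_prod]
  exact Nat.mul_le_mul_left _ (Set.ncard_union_le _ _)

theorem finite_le_dist_of_subset_levelPairs {C : ℕ → Set T} (hC : ∀ n, (C n).Finite) {R : ℕ → ℝ}
    (hR : Filter.Tendsto R Filter.atTop (nhds 0)) {J : Set (T × T)}
    (hJ : J ⊆ ⋃ n, levelPairs C R n) {ε : ℝ} (hε : 0 < ε) :
    {p : J | ε ≤ dist p.1.1 p.1.2}.Finite := by
  obtain ⟨m, hm⟩ := Filter.eventually_atTop.1 (hR.eventually (gt_mem_nhds hε))
  have hfin : (⋃ n ∈ Set.Iio m, levelPairs C R n).Finite :=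
    (Set.finite_Iio m).biUnion fun n _ => finite_levelPairs hC R n
  refine (hfin.preimage (Subtype.val_injective (p := (· ∈ J))).injOn).subset fun p hp => ?_
  obtain ⟨n, hn⟩ := Set.mem_iUnion.1 (hJ p.2)
  refine Set.mem_biUnion (x := n) ?_ hn
  by_contra h
  exact absurd (hp.trans hn.2.2.2) (not_le.2 (hm n (not_lt.1 h)))

/-- With `r_n = θ * ρ ^ n`, `c = (1 + ρ) / (1 - ρ)` and `a x n` a centre of level `n` near `x`, the
path `s`, `a s n`, `a t n`, `t` costs `c * r_n` at either end and at most `d(s,t) + 2 * r_n` in the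
middle. So `n` must satisfy `(2 * c + 2) * r_n ≤ δ * d(s,t)`, yet `r_n` must be large enough for the
middle step to be a pair of level `n`. `hK2` and `hK3` make both possible. -/
theorem norm_sub_le_of_levelPairs {C : ℕ → Set T} {θ ρ δ K : ℝ} (hθ : 0 < θ) (hρ : 0 < ρ)
    (hρ1 : ρ < 1) (hδ : 0 < δ) (hC : ∀ n x, ∃ y ∈ C n, dist x y ≤ θ * ρ ^ n)
    (hK1 : 2 ≤ K) (hK2 : (2 * ((1 + ρ) / (1 - ρ)) + 2) / (ρ * δ) ≤ K - 2)
    (hK3 : ∀ x y : T, dist x y ≤ (K - 2) * θ) {f : T → ℂ} (hf : Continuous f)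
    (hpair : ∀ n, ∀ p ∈ levelPairs C (fun n => K * (θ * ρ ^ n)) n,
      ‖f p.1 - f p.2‖ ≤ dist p.1 p.2) (s t : T) :
    ‖f s - f t‖ ≤ (1 + δ) * dist s t := by
  rcases eq_or_ne s t with rfl | hst
  · simp
  choose a ha hd using fun x n => hC n x
  have hr : ∀ n, 0 < θ * ρ ^ n := fun n => by positivity
  have h1ρ : 0 < 1 - ρ := by linarith
  have hpair' : ∀ n x y, x ∈ C n → y ∈ C n ∪ C (n + 1) → dist x y ≤ K * (θ * ρ ^ n) →
      dist (f x) (f y) ≤ dist x y := fun n x y hx hy hxy => by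
    rcases eq_or_ne x y with rfl | hne
    · simp
    · rw [dist_eq_norm]; exact hpair n (x, y) ⟨hne, hx, hy, hxy⟩
  have htail : ∀ x n, dist (f (a x n)) (f x) ≤ θ * (1 + ρ) * ρ ^ n / (1 - ρ) := fun x n => by
    have hstep : ∀ m, dist (a x m) (a x (m + 1)) ≤ θ * (1 + ρ) * ρ ^ m := fun m => by
      refine (dist_triangle_left _ _ x).trans ((add_le_add (hd x m) (hd x (m + 1))).trans
        (le_of_eq ?_))
      ring
    refine dist_le_of_le_geometric_of_tendsto ρ (θ * (1 + ρ)) hρ1 (fun m => ?_)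
      ((hf.tendsto x).comp ?_) n
    -- Consecutive centres are at distance at most `(1 + ρ) * r_m ≤ 2 * r_m ≤ K * r_m`, so they form
    -- a pair of level `m` unless they coincide.
    · refine (hpair' m _ _ (ha x m) (.inr (ha x (m + 1))) ((hstep m).trans ?_)).trans (hstep m)
      nlinarith [hr m]
    · rw [tendsto_iff_dist_tendsto_zero]
      refine squeeze_zero (fun _ => dist_nonneg) (fun m => (dist_comm _ _).trans_le (hd x m)) ?_
      simpa using (tendsto_pow_atTop_nhds_zero_of_lt_one hρ.le hρ1).const_mul θ
  set c := (1 + ρ) / (1 - ρ) with hc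
  have hc0 : 0 < c := by positivity
  have hℓ := dist_pos.2 hst
  have hex : ∃ n, (2 * c + 2) * (θ * ρ ^ n) ≤ δ * dist s t := by
    have : Filter.Tendsto (fun n => (2 * c + 2) * (θ * ρ ^ n)) Filter.atTop (nhds 0) := by
      simpa using ((tendsto_pow_atTop_nhds_zero_of_lt_one hρ.le hρ1).const_mul θ).const_mul
        (2 * c + 2)
    exact (this.eventually (ge_mem_nhds (mul_pos hδ hℓ))).exists
  obtain ⟨n, hn, hnK⟩ : ∃ n, (2 * c + 2) * (θ * ρ ^ n) ≤ δ * dist s t ∧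
      dist s t ≤ (K - 2) * (θ * ρ ^ n) := by
    classical
    -- The least suitable `n` works: if it is `0`, the diameter bound `hK3` applies; otherwise `n -
    -- 1` fails, and `r_{n-1} = r_n / ρ` explains the `ρ * δ` in `hK2`.
    refine ⟨Nat.find hex, Nat.find_spec hex, ?_⟩
    rcases h0 : Nat.find hex with _ | m
    · simpa using hK3 s t
    · have hm := Nat.find_min hex (m := m) (by omega)
      rw [not_le] at hm
      rw [div_le_iff₀ (by positivity)] at hK2
      have h2 : (2 * c + 2) * (θ * ρ ^ m) ≤ (K - 2) * (ρ * δ) * (θ * ρ ^ m) :=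
        mul_le_mul_of_nonneg_right hK2 (hr m).le
      have h3 : δ * dist s t ≤ δ * ((K - 2) * (θ * ρ ^ (m + 1))) := by
        rw [pow_succ]; nlinarith
      exact le_of_mul_le_mul_left h3 hδ
  have hdist : dist (a s n) (a t n) ≤ 2 * (θ * ρ ^ n) + dist s t := by
    have h1 := dist_triangle4 (a s n) s t (a t n)
    have h2 := hd s n
    have h3 := hd t n
    rw [dist_comm] at h2
    linarith
  -- The margin 2 in `K - 2` pays for moving `s` and `t` to their centres.
  have hmid := hpair' n (a s n) (a t n) (ha s n) (.inl (ha t n)) (by linarith)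
  have hs := htail s n
  have ht := htail t n
  have heq : θ * (1 + ρ) * ρ ^ n / (1 - ρ) = c * (θ * ρ ^ n) := by rw [hc]; ring
  rw [heq] at hs ht
  rw [← dist_eq_norm]
  have h4 := dist_triangle4 (f s) (f (a s n)) (f (a t n)) (f t)
  rw [dist_comm (f s) (f (a s n))] at h4
  linarith

end LevelPairs

/-! ### Estimates for the weights of the pairs. -/

section Weights

theorem inv_one_add_inv_sq_rpow_le {d s : ℝ} (hd : 0 < d) (hs : 0 ≤ s) :
    ((1 + (d ^ 2)⁻¹)⁻¹) ^ (s / 2) ≤ d ^ s := by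
  have h : (1 + (d ^ 2)⁻¹)⁻¹ ≤ d ^ 2 := by
    rw [inv_le_comm₀ (by positivity) (by positivity)]
    linarith
  calc ((1 + (d ^ 2)⁻¹)⁻¹) ^ (s / 2) ≤ (d ^ 2) ^ (s / 2) := by gcongr
    _ = d ^ s := by
      rw [← Real.rpow_natCast d 2, ← Real.rpow_mul hd.le]
      congr 1
      push_cast
      ring

/-- This is `r² * (1 + d⁻²) ≤ b² + 1` raised to the power `s / 2`; a common bound `b` on the radii
makes the constant independent of the level. -/
theorem le_inv_one_add_inv_sq_rpow {r d s b : ℝ} (hr : 0 < r) (hrd : r ≤ d) (hrb : r ≤ b)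
    (hs : 0 ≤ s) : r ^ s ≤ (1 + b ^ 2) ^ (s / 2) * ((1 + (d ^ 2)⁻¹)⁻¹) ^ (s / 2) := by
  have hd : 0 < d := hr.trans_le hrd
  have h : r ^ 2 ≤ (1 + b ^ 2) * (1 + (d ^ 2)⁻¹)⁻¹ := by
    rw [← div_eq_mul_inv, le_div_iff₀ (by positivity)]
    have h1 : r ^ 2 * (d ^ 2)⁻¹ ≤ 1 := by
      rw [← div_eq_mul_inv, div_le_one (by positivity)]
      gcongr
    have h2 : r ^ 2 ≤ b ^ 2 := by gcongr
    linarith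
  rw [← Real.mul_rpow (by positivity) (by positivity)]
  calc r ^ s = (r ^ 2) ^ (s / 2) := by
        rw [← Real.rpow_natCast r 2, ← Real.rpow_mul hr.le]
        congr 1
        push_cast
        ring
    _ ≤ _ := by gcongr

/-- Choosing one level for each element embeds `J` into the disjoint union of the levels, so
overlaps between levels do no harm. -/
theorem summable_subtype_of_subset_iUnion {α : Type u} {L : ℕ → Set α} (hL : ∀ n, (L n).Finite)
    {J : Set α} (hJ : J ⊆ ⋃ n, L n) {w : α → ℝ} (hw : ∀ p, 0 ≤ w p) {b : ℕ → ℝ}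
    (hb : ∀ n, ∀ p ∈ L n, w p ≤ b n) (hsum : Summable fun n => ((L n).ncard : ℝ) * b n) :
    Summable fun p : J => w p := by
  have hfin : ∀ n, Finite (L n) := hL
  have hsigma : Summable fun x : Σ n, L n => w x.2 := by
    rw [summable_sigma_of_nonneg fun _ => hw _]
    refine ⟨fun n => Summable.of_finite, hsum.of_nonneg_of_le
      (fun n => tsum_nonneg fun _ => hw _) fun n => ?_⟩
    have := Fintype.ofFinite (L n)
    rw [tsum_fintype, ← Nat.card_coe_set_eq, Nat.card_eq_fintype_card, ← nsmul_eq_mul]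
    exact Finset.sum_le_card_nsmul _ _ _ fun p _ => hb n p p.2
  choose k hk using fun p : J => Set.mem_iUnion.1 (hJ p.2)
  refine hsigma.comp_injective (i := fun p : J => ⟨k p, p.1, hk p⟩) fun p q h => ?_
  exact Subtype.ext (congrArg (fun x : Σ n, L n => (x.2 : α)) h)

end Weights

/-! ### Covering numbers and the upper Minkowski dimension. -/

section Dimension

variable {T : Type u} [MetricSpace T]

/-- The covering number of the whole space as a natural number. -/
def coveringCount (T : Type u) [MetricSpace T] (r : ℝ≥0) : ℕ :=
  (Metric.coveringNumber r (Set.univ : Set T)).toNat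

theorem IsMinimalCentres.ncard_eq {r : ℝ≥0} {C : Set T} (hC : IsMinimalCentres r C) :
    C.ncard = coveringCount T r := by
  rw [coveringCount, ← hC.2]
  rfl

theorem IsMinimalCentres.exists_dist_le {r : ℝ≥0} {C : Set T} (hC : IsMinimalCentres r C) (x : T) :
    ∃ y ∈ C, dist x y ≤ r := by
  have := Metric.isCover_iff_subset_iUnion_closedBall.1 hC.1 (Set.mem_univ x)
  simpa using this

theorem coveringNumber_ne_top [CompactSpace T] {r : ℝ≥0} (hr : r ≠ 0) :
    Metric.coveringNumber r (Set.univ : Set T) ≠ ⊤ := by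
  obtain ⟨C, hfin, hC⟩ := exists_isMinimalCentres (T := T) hr
  rw [← hC.2]
  exact Set.encard_ne_top_iff.2 hfin

theorem IsMinimalCentres.finite [CompactSpace T] {r : ℝ≥0} (hr : r ≠ 0) {C : Set T}
    (hC : IsMinimalCentres r C) : C.Finite := by
  rw [← Set.encard_ne_top_iff, hC.2]
  exact coveringNumber_ne_top hr

theorem coveringCount_anti [CompactSpace T] {r s : ℝ≥0} (hr : r ≠ 0) (hrs : r ≤ s) :
    coveringCount T s ≤ coveringCount T r :=
  ENat.toNat_le_toNat (Metric.coveringNumber_anti hrs) (coveringNumber_ne_top hr)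

theorem coveringCount_pos [CompactSpace T] [Nonempty T] {r : ℝ≥0} (hr : r ≠ 0) :
    0 < coveringCount T r := by
  rw [Nat.pos_iff_ne_zero, coveringCount, Ne, ENat.toNat_eq_zero, not_or]
  exact ⟨(Metric.coveringNumber_pos_iff.2 Set.univ_nonempty).ne', coveringNumber_ne_top hr⟩

theorem upperMinkowskiDim_eq : upperMinkowskiDim T = Filter.limsup (fun r : ℝ≥0 =>
    ((Real.log (coveringCount T r) / -Real.log (r : ℝ) : ℝ) : EReal))
      (nhdsWithin 0 (Set.Ioi 0)) := rfl

theorem eventually_pos_and_lt {b : ℝ≥0} (hb : 0 < b) :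
    ∀ᶠ r : ℝ≥0 in nhdsWithin 0 (Set.Ioi 0), 0 < r ∧ r < b :=
  Filter.eventually_of_mem (Ioo_mem_nhdsGT hb) fun _ h => h

theorem upperMinkowskiDim_nonneg : 0 ≤ upperMinkowskiDim T := by
  rw [upperMinkowskiDim_eq]
  refine Filter.le_limsup_of_frequently_le (Filter.Eventually.frequently ?_)
  filter_upwards [eventually_pos_and_lt zero_lt_one] with r hr
  rw [← EReal.coe_zero, EReal.coe_le_coe_iff]
  have : Real.log r < 0 := Real.log_neg hr.1 hr.2
  exact div_nonneg (Real.log_natCast_nonneg _) (by linarith)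

theorem eventually_coveringCount_le {a : ℝ} (ha : upperMinkowskiDim T < a) :
    ∀ᶠ r : ℝ≥0 in nhdsWithin 0 (Set.Ioi 0), (coveringCount T r : ℝ) ≤ (r : ℝ) ^ (-a) := by
  rw [upperMinkowskiDim_eq] at ha
  filter_upwards [Filter.eventually_lt_of_limsup_lt ha, eventually_pos_and_lt zero_lt_one]
    with r h hr
  have hlog : Real.log r < 0 := Real.log_neg hr.1 hr.2
  rw [EReal.coe_lt_coe_iff, div_lt_iff₀ (by linarith)] at h
  -- This form of the inequality also covers a count of `0`, which occurs when `T` is empty.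
  refine (Real.le_exp_log _).trans ?_
  rw [Real.rpow_def_of_pos (by exact_mod_cast hr.1)]
  exact Real.exp_le_exp.2 (by linarith)

/-- The constant `B` contributes `log B / (-log r)`, which tends to `0`. -/
theorem upperMinkowskiDim_le_of_eventually {B s : ℝ}
    (h : ∀ᶠ r : ℝ≥0 in nhdsWithin 0 (Set.Ioi 0),
      0 < coveringCount T r ∧ (coveringCount T r : ℝ) ≤ B * (r : ℝ) ^ (-s)) :
    upperMinkowskiDim T ≤ s := by
  have hlim : Filter.Tendsto (fun r : ℝ≥0 => Real.log B / -Real.log (r : ℝ) + s)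
      (nhdsWithin 0 (Set.Ioi 0)) (nhds s) := by
    have hcoe : Filter.Tendsto (fun r : ℝ≥0 => (r : ℝ)) (nhdsWithin 0 (Set.Ioi 0))
        (nhdsWithin 0 (Set.Ioi 0)) := by
      refine tendsto_nhdsWithin_iff.2 ⟨?_, ?_⟩
      · exact (NNReal.continuous_coe.tendsto 0).mono_left nhdsWithin_le_nhds
      · filter_upwards [self_mem_nhdsWithin] with r hr
        exact hr
    have := (Filter.tendsto_neg_atBot_atTop.comp (Real.tendsto_log_nhdsGT_zero.comp hcoe))
    simpa using (this.const_div_atTop (Real.log B)).add_const s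
  rw [upperMinkowskiDim_eq,
    ← ((continuous_coe_real_ereal.tendsto s).comp hlim).limsup_eq]
  refine Filter.limsup_le_limsup ?_
  filter_upwards [h, eventually_pos_and_lt zero_lt_one] with r hN hr
  have hlog : 0 < -Real.log r := neg_pos.2 (Real.log_neg hr.1 hr.2)
  have hr0 : (0 : ℝ) < r := by exact_mod_cast hr.1
  have hN0 : (0 : ℝ) < coveringCount T r := by exact_mod_cast hN.1
  have hrs := Real.rpow_pos_of_pos hr0 (-s)
  have hB : 0 < B := pos_of_mul_pos_left (hN0.trans_le hN.2) hrs.le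
  rw [Function.comp_apply, EReal.coe_le_coe_iff, div_add' _ _ _ hlog.ne']
  refine div_le_div_of_nonneg_right ?_ hlog.le
  refine (Real.log_le_log hN0 hN.2).trans (le_of_eq ?_)
  rw [Real.log_mul hB.ne' hrs.ne', Real.log_rpow hr0]
  ring

/-- It suffices to bound the covering numbers along a geometric sequence of radii. -/
theorem upperMinkowskiDim_le_of_geometric [CompactSpace T] [Nonempty T] {θ ρ : ℝ≥0} (hθ : 0 < θ)
    (hρ : 0 < ρ) (hρ1 : ρ < 1) {s B : ℝ} (hs : 0 ≤ s)
    (h : ∀ᶠ n : ℕ in Filter.atTop,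
      (coveringCount T (θ * ρ ^ n) : ℝ) * ((θ * ρ ^ n : ℝ≥0) : ℝ) ^ s ≤ B) :
    upperMinkowskiDim T ≤ s := by
  obtain ⟨m, hm⟩ := Filter.eventually_atTop.1 h
  refine upperMinkowskiDim_le_of_eventually (B := B * (ρ : ℝ) ^ (-s)) ?_
  filter_upwards [eventually_pos_and_lt (b := θ * ρ ^ m) (by positivity)] with r hr
  refine ⟨coveringCount_pos hr.1.ne', ?_⟩
  have hrθ : r ≤ θ := hr.2.le.trans (mul_le_of_le_one_right' (pow_le_one' hρ1.le m))
  -- With `r_{n+1} < r ≤ r_n`, the count at `r` is at most the count at `r_{n+1}`, and `r * ρ ≤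
  -- r_{n+1}` costs the factor `ρ ^ (-s)`.
  obtain ⟨n, hn, hn'⟩ := exists_nat_pow_near_of_lt_one (x := r / θ) (div_pos hr.1 hθ)
    (div_le_one_of_le₀ hrθ hθ.le) hρ hρ1
  rw [lt_div_iff₀ hθ, mul_comm] at hn
  rw [div_le_iff₀ hθ, mul_comm] at hn'
  have hmn : m ≤ n + 1 := by
    by_contra! hlt
    have : θ * ρ ^ m ≤ θ * ρ ^ (n + 1) := by
      gcongr θ * ?_
      exact pow_le_pow_of_le_one zero_le hρ1.le hlt.le
    exact absurd (hn.trans hr.2) (not_lt.2 this)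
  have hpos : 0 < θ * ρ ^ (n + 1) := by positivity
  have hcount : (coveringCount T r : ℝ) ≤ coveringCount T (θ * ρ ^ (n + 1)) := by
    exact_mod_cast coveringCount_anti hpos.ne' hn.le
  have hposR : (0 : ℝ) < ((θ * ρ ^ (n + 1) : ℝ≥0) : ℝ) := by exact_mod_cast hpos
  have hB := hm (n + 1) hmn
  have hB0 : 0 ≤ B := le_trans (by positivity) hB
  have hr0 : (0 : ℝ) < r := by exact_mod_cast hr.1
  have hρ0 : (0 : ℝ) < ρ := by exact_mod_cast hρ
  have hle : (r : ℝ) * ρ ≤ ((θ * ρ ^ (n + 1) : ℝ≥0) : ℝ) := by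
    have : r * ρ ≤ θ * ρ ^ (n + 1) := by
      rw [pow_succ, ← mul_assoc]
      gcongr
    exact_mod_cast this
  calc (coveringCount T r : ℝ) ≤ coveringCount T (θ * ρ ^ (n + 1)) := hcount
    _ ≤ B * ((θ * ρ ^ (n + 1) : ℝ≥0) : ℝ) ^ (-s) := by
      rw [Real.rpow_neg hposR.le, ← div_eq_mul_inv, le_div_iff₀ (by positivity)]
      exact hB
    _ ≤ B * ((r : ℝ) * ρ) ^ (-s) := by
      gcongr B * ?_
      exact Real.rpow_le_rpow_of_nonpos (by positivity) hle (by linarith)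
    _ = B * (ρ : ℝ) ^ (-s) * (r : ℝ) ^ (-s) := by
      rw [Real.mul_rpow hr0.le hρ0.le]; ring

end Dimension

/-! ### Summability above twice the dimension. -/

section Summability

variable {T : Type u} [MetricSpace T] [CompactSpace T]

theorem tendsto_mul_pow_nhdsGT {θ ρ : ℝ≥0} (hθ : 0 < θ) (hρ : 0 < ρ) (hρ1 : ρ < 1) :
    Filter.Tendsto (fun n : ℕ => θ * ρ ^ n) Filter.atTop (nhdsWithin 0 (Set.Ioi 0)) := by
  refine tendsto_nhdsWithin_iff.2 ⟨?_, .of_forall fun n => ?_⟩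
  · simpa using (tendsto_pow_atTop_nhds_zero_of_lt_one zero_le hρ1).const_mul θ
  · exact mul_pos hθ (pow_pos hρ n)

/-- For `a` above the dimension with `2 * a < s`, level `n` has eventually at most `2 * r_{n+1} ^
(-2 * a)` pairs, and the series is dominated by a geometric one of ratio `ρ ^ (s - 2 * a) < 1`. -/
theorem summable_levelPairs_bound {θ ρ : ℝ≥0} (hθ : 0 < θ) (hρ : 0 < ρ) (hρ1 : ρ < 1)
    {C : ℕ → Set T} (hC : ∀ n, IsMinimalCentres (θ * ρ ^ n) (C n)) {K : ℝ} (hK : 0 ≤ K)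
    {R : ℕ → ℝ} {s : ℝ} (hdim : 2 * upperMinkowskiDim T < s) :
    Summable fun n => ((levelPairs C R n).ncard : ℝ) * (K * (θ * ρ ^ n : ℝ≥0)) ^ s := by
  have hr : ∀ n, θ * ρ ^ n ≠ 0 := fun n => (mul_pos hθ (pow_pos hρ n)).ne'
  obtain ⟨a, ha, has⟩ : ∃ a : ℝ, upperMinkowskiDim T < a ∧ 2 * a < s := by
    have h0 := upperMinkowskiDim_nonneg (T := T)
    induction h : upperMinkowskiDim T with
    | bot => rw [h] at h0; simp at h0
    | top => rw [h, EReal.mul_top_of_pos (by norm_num)] at hdim; simp at hdim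
    | coe d =>
      rw [h] at hdim
      have hd : 2 * d < s := EReal.coe_lt_coe_iff.1 (by rw [EReal.coe_mul]; exact hdim)
      exact ⟨(d + s / 2) / 2, by rw [EReal.coe_lt_coe_iff]; linarith, by linarith⟩
  have hθ0 : (0 : ℝ) < θ := by exact_mod_cast hθ
  have hρ0 : (0 : ℝ) < ρ := by exact_mod_cast hρ
  have hρ1' : (ρ : ℝ) < 1 := by exact_mod_cast hρ1
  have hq0 : 0 ≤ (ρ : ℝ) ^ (s - 2 * a) := by positivity
  have hq1 : (ρ : ℝ) ^ (s - 2 * a) < 1 := Real.rpow_lt_one hρ0.le hρ1' (by linarith)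
  refine Summable.of_norm_bounded_eventually_nat
    (g := fun n => (2 * K ^ s * (θ : ℝ) ^ (s - 2 * a) * (ρ : ℝ) ^ (-(2 * a))) *
      ((ρ : ℝ) ^ (s - 2 * a)) ^ n)
    ((summable_geometric_of_lt_one hq0 hq1).mul_left _) ?_
  have hev := ((tendsto_mul_pow_nhdsGT hθ hρ hρ1).comp (Filter.tendsto_add_atTop_nat 1)).eventually
    (eventually_coveringCount_le ha)
  filter_upwards [hev] with n hn
  simp only [Function.comp_apply] at hn
  have hfin : ∀ n, (C n).Finite := fun n => (hC n).finite (hr n)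
  have hmono : (C n).ncard ≤ (C (n + 1)).ncard := by
    rw [(hC n).ncard_eq, (hC (n + 1)).ncard_eq]
    refine coveringCount_anti (hr _) ?_
    gcongr θ * ?_
    exact pow_le_pow_of_le_one zero_le hρ1.le n.le_succ
  rw [← (hC (n + 1)).ncard_eq] at hn
  have hcard : ((levelPairs C R n).ncard : ℝ) ≤
      2 * (((θ * ρ ^ (n + 1) : ℝ≥0) : ℝ) ^ (-a)) ^ 2 := by
    have h1 : (levelPairs C R n).ncard ≤ 2 * (C (n + 1)).ncard ^ 2 := by
      refine (ncard_levelPairs_le hfin R n).trans ?_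
      nlinarith
    calc ((levelPairs C R n).ncard : ℝ) ≤ 2 * ((C (n + 1)).ncard : ℝ) ^ 2 := by exact_mod_cast h1
      _ ≤ _ := by gcongr
  have hx : (0 : ℝ) < (ρ : ℝ) ^ n := by positivity
  rw [Real.norm_of_nonneg (by positivity)]
  refine (mul_le_mul_of_nonneg_right hcard (by positivity)).trans (le_of_eq ?_)
  push_cast
  rw [Real.mul_rpow hK (by positivity), Real.mul_rpow hθ0.le hx.le, pow_succ (ρ : ℝ) n,
    Real.mul_rpow hθ0.le (by positivity), Real.mul_rpow hx.le hρ0.le, ← Real.rpow_natCast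
    ((ρ : ℝ) ^ (s - 2 * a)) n, ← Real.rpow_mul hρ0.le, mul_comm (s - 2 * a) (n : ℝ),
    Real.rpow_mul hρ0.le, Real.rpow_natCast, Real.rpow_sub hθ0, Real.rpow_sub hx,
    Real.rpow_neg hθ0.le, Real.rpow_neg hx.le, Real.rpow_neg hρ0.le, Real.rpow_neg hρ0.le,
    mul_comm 2 a,
    Real.rpow_mul hθ0.le, Real.rpow_mul hx.le, Real.rpow_mul hρ0.le]
  norm_num [Real.rpow_two]
  field_simp

theorem isSummable_of_subset_levelPairs {θ ρ : ℝ≥0} (hθ : 0 < θ) (hρ : 0 < ρ) (hρ1 : ρ < 1)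
    {C : ℕ → Set T} (hC : ∀ n, IsMinimalCentres (θ * ρ ^ n) (C n)) {K : ℝ} (hK : 0 ≤ K)
    {J : Set (T × T)} (hJ : J ⊆ ⋃ n, levelPairs C (fun n => K * (θ * ρ ^ n)) n) {s : ℝ}
    (hdim : 2 * upperMinkowskiDim T < s) : IsSummable (pairDirac J) s := by
  have hs : 0 < s := by
    have h : (0 : EReal) ≤ 2 * upperMinkowskiDim T :=
      mul_nonneg (by norm_num) upperMinkowskiDim_nonneg
    exact_mod_cast h.trans_lt hdim
  have hfin : ∀ n, (C n).Finite := fun n => (hC n).finite (mul_pos hθ (pow_pos hρ n)).ne'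
  rw [isSummable_pairDirac_iff hs]
  refine summable_subtype_of_subset_iUnion (fun n => finite_levelPairs hfin _ n) hJ
    (w := fun p => ((1 + (dist p.1 p.2 ^ 2)⁻¹)⁻¹ : ℝ) ^ (s / 2)) (fun p => by positivity)
    (fun n p hp => ?_) (summable_levelPairs_bound hθ hρ hρ1 hC hK hdim)
  refine (inv_one_add_inv_sq_rpow_le (dist_pos.2 hp.1) hs.le).trans ?_
  refine Real.rpow_le_rpow dist_nonneg ?_ hs.le
  simpa using hp.2.2.2

end Summability

/-! ### The dimension bound for connected spaces. -/

section Connected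

variable {T : Type u} [MetricSpace T]

/-- Since `p` and `q` are `4 * r` apart, some point has distance at least `2 * r` from `x`; by
connectedness some point has distance exactly `2 * r`, and a centre within `r` of it serves. -/
theorem exists_dist_mem_Icc [PreconnectedSpace T] {C : Set T} {r : ℝ}
    (hC : ∀ x, ∃ y ∈ C, dist x y ≤ r) {p q : T} (hpq : 4 * r ≤ dist p q) (x : T) :
    ∃ y ∈ C, r ≤ dist x y ∧ dist x y ≤ 3 * r := by
  have hr : 0 ≤ r := by
    obtain ⟨y, -, hy⟩ := hC x
    exact dist_nonneg.trans hy
  obtain ⟨z, hz⟩ : ∃ z, 2 * r ≤ dist x z := by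
    by_contra! h
    linarith [dist_triangle_left p q x, h p, h q]
  obtain ⟨z', hz'⟩ := intermediate_value_univ x z (f := fun y => dist x y) (by fun_prop)
    ⟨by simpa using hr, hz⟩
  obtain ⟨y, hy, hyd⟩ := hC z'
  simp only at hz'
  refine ⟨y, hy, ?_, ?_⟩
  · linarith [dist_triangle_right x z' y, dist_triangle x y z', dist_comm y z']
  · linarith [dist_triangle x z' y]

/-- Each point of `C` is assigned a pair of `J` that has it as an end and length at least `r`. A
pair has two ends, hence the factor 2, and its weight is at least a constant times `r ^ s`. -/
theorem ncard_mul_rpow_le {C : Set T} (hC : C.Finite) {J : Set (T × T)} {r b s : ℝ} (hr : 0 < r)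
    (hrb : r ≤ b) (hs : 0 ≤ s)
    (hJ : ∀ x ∈ C, ∃ y, r ≤ dist x y ∧ ((x, y) ∈ J ∨ (y, x) ∈ J))
    (hsum : Summable fun p : J => ((1 + (dist p.1.1 p.1.2 ^ 2)⁻¹)⁻¹ : ℝ) ^ (s / 2)) :
    (C.ncard : ℝ) * r ^ s ≤ 2 * ((1 + b ^ 2) ^ (s / 2) *
      ∑' p : J, ((1 + (dist p.1.1 p.1.2 ^ 2)⁻¹)⁻¹ : ℝ) ^ (s / 2)) := by
  classical
  have hg : ∀ x : T, ∃ p : T × T, x ∈ C → p ∈ J ∧ r ≤ dist p.1 p.2 ∧ (x = p.1 ∨ x = p.2) := by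
    intro x
    by_cases hx : x ∈ C
    · obtain ⟨y, hy, h | h⟩ := hJ x hx
      · exact ⟨(x, y), fun _ => ⟨h, hy, .inl rfl⟩⟩
      · exact ⟨(y, x), fun _ => ⟨h, by rwa [dist_comm], .inr rfl⟩⟩
    · exact ⟨(x, x), fun h => absurd h hx⟩
  choose g hg using hg
  let F : Finset T := hC.toFinset
  have hF : ∀ x ∈ F, x ∈ C := fun x hx => hC.mem_toFinset.1 hx
  have hcard : F.card ≤ 2 * (F.image g).card := by
    refine Finset.card_le_mul_card_image F 2 fun p _ => ?_
    refine (Finset.card_le_card (t := {p.1, p.2}) fun x hx => ?_).trans Finset.card_le_two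
    obtain ⟨hxF, rfl⟩ := Finset.mem_filter.1 hx
    simpa using (hg x (hF x hxF)).2.2
  let w : T × T → ℝ := fun p => ((1 + (dist p.1 p.2 ^ 2)⁻¹)⁻¹ : ℝ) ^ (s / 2)
  have hw : ∀ p, 0 ≤ w p := fun p => by positivity
  have hmem : ∀ p ∈ F.image g, p ∈ J ∧ r ≤ dist p.1 p.2 := fun p hp => by
    obtain ⟨x, hx, rfl⟩ := Finset.mem_image.1 hp
    exact ⟨(hg x (hF x hx)).1, (hg x (hF x hx)).2.1⟩
  have hle : ∑ p ∈ F.image g, w p ≤ ∑' p : J, w p := by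
    rw [← Finset.sum_subtype_of_mem w fun p hp => (hmem p hp).1]
    exact hsum.sum_le_tsum _ fun p _ => hw p
  have hlow : ((F.image g).card : ℝ) * r ^ s ≤ (1 + b ^ 2) ^ (s / 2) * ∑ p ∈ F.image g, w p := by
    rw [Finset.mul_sum, ← nsmul_eq_mul]
    exact Finset.card_nsmul_le_sum _ _ _ fun p hp =>
      le_inv_one_add_inv_sq_rpow hr (hmem p hp).2 hrb hs
  calc (C.ncard : ℝ) * r ^ s = (F.card : ℝ) * r ^ s := by
        rw [Set.ncard_eq_toFinset_card C hC]
    _ ≤ (2 * (F.image g).card) * r ^ s := by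
        gcongr
        exact_mod_cast hcard
    _ = 2 * ((F.image g).card * r ^ s) := by ring
    _ ≤ 2 * ((1 + b ^ 2) ^ (s / 2) * ∑ p ∈ F.image g, w p) := by gcongr
    _ ≤ _ := by gcongr

theorem upperMinkowskiDim_le_of_isSummable [CompactSpace T] [ConnectedSpace T] {θ ρ : ℝ≥0}
    (hθ : 0 < θ) (hρ : 0 < ρ) (hρ1 : ρ < 1) {C : ℕ → Set T}
    (hC : ∀ n, IsMinimalCentres (θ * ρ ^ n) (C n)) {K : ℝ} (hK : 3 ≤ K) {J : Set (T × T)}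
    (hJ : ∀ n x y, (x, y) ∈ levelPairs C (fun n => K * (θ * ρ ^ n)) n → (x, y) ∈ J ∨ (y, x) ∈ J)
    {s : ℝ} (hs : 0 < s) (hsum : IsSummable (pairDirac J) s) : upperMinkowskiDim T ≤ s := by
  rw [isSummable_pairDirac_iff hs] at hsum
  have hr : ∀ n, 0 < θ * ρ ^ n := fun n => mul_pos hθ (pow_pos hρ n)
  have hrθ : ∀ n, θ * ρ ^ n ≤ θ := fun n => mul_le_of_le_one_right' (pow_le_one' hρ1.le n)
  have hfin : ∀ n, (C n).Finite := fun n => (hC n).finite (hr n).ne'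
  rcases subsingleton_or_nontrivial T with hT | hT
  · refine upperMinkowskiDim_le_of_geometric hθ hρ hρ1 hs.le (B := (θ : ℝ) ^ s)
      (.of_forall fun n => ?_)
    have h1 : coveringCount T (θ * ρ ^ n) ≤ 1 := by
      rw [← (hC n).ncard_eq]
      exact Set.ncard_le_one_iff_subsingleton.2 Set.subsingleton_of_subsingleton
    calc (coveringCount T (θ * ρ ^ n) : ℝ) * ((θ * ρ ^ n : ℝ≥0) : ℝ) ^ s
        ≤ 1 * ((θ : ℝ≥0) : ℝ) ^ s := by
          gcongr
          · exact_mod_cast h1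
          · exact hrθ n
      _ = _ := one_mul _
  · obtain ⟨p, q, hpq⟩ := exists_pair_ne T
    refine upperMinkowskiDim_le_of_geometric hθ hρ hρ1 hs.le
      (B := 2 * ((1 + (θ : ℝ) ^ 2) ^ (s / 2) *
        ∑' p : J, ((1 + (dist p.1.1 p.1.2 ^ 2)⁻¹)⁻¹ : ℝ) ^ (s / 2))) ?_
    have hlim : Filter.Tendsto (fun n : ℕ => 4 * ((θ * ρ ^ n : ℝ≥0) : ℝ)) Filter.atTop
        (nhds 0) := by
      simpa using ((NNReal.continuous_coe.tendsto 0).comp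
        ((tendsto_mul_pow_nhdsGT hθ hρ hρ1).mono_right nhdsWithin_le_nhds)).const_mul 4
    filter_upwards [hlim.eventually (ge_mem_nhds (dist_pos.2 hpq))] with n hn
    have hrR : (0 : ℝ) < ((θ * ρ ^ n : ℝ≥0) : ℝ) := by exact_mod_cast hr n
    rw [← (hC n).ncard_eq]
    refine ncard_mul_rpow_le (hfin n) hrR (by exact_mod_cast hrθ n) hs.le (fun x hx => ?_) hsum
    obtain ⟨y, hy, h1, h2⟩ := exists_dist_mem_Icc (hC n).exists_dist_le hn x
    refine ⟨y, h1, hJ n x y ⟨dist_pos.1 (hrR.trans_le h1), hx, .inl hy, h2.trans ?_⟩⟩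
    have := mul_le_mul_of_nonneg_right hK hrR.le
    simpa using this

end Connected

end SpectralTriple

end

/-! ### Choice of `K` and assembly. -/

open SpectralTriple in
theorem theorem3p2 {T : Type*} [MetricSpace T] [CompactSpace T]
    (δ : ℝ) (hδ : 0 < δ)
    (θ ρ : ℝ≥0) (hθ : 0 < θ) (hρ : 0 < ρ) (hρ1 : ρ < 1)
    (C : ℕ → Set T) (hC : ∀ n, IsMinimalCentres (θ * ρ ^ n) (C n)) :
    ∃ J : Set (T × T),
      J.Countable ∧
      -- `J` lists unordered pairs of distinct points, each of them once
      (∀ x y, (x, y) ∈ J → (y, x) ∉ J) ∧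
      (∀ x y, (x, y) ∈ J → ∃ n, x ∈ C n ∧ y ∈ C n ∪ C (n + 1)) ∧
      IsSpectralTriple (pairRep J) (pairDirac J) ∧
      -- the distance induced on `T` is a (finite) metric `dδ` with `d ≤ dδ ≤ (1 + δ) d`
      (∃ dδ : T → T → ℝ,
        (∀ s t, inducedDist (pairRep J) (pairDirac J) (pointState s) (pointState t) =
          ENNReal.ofReal (dδ s t)) ∧
        (∀ s t, dδ s t = 0 ↔ s = t) ∧
        (∀ s t, dδ s t = dδ t s) ∧
        (∀ r s t, dδ r t ≤ dδ r s + dδ s t) ∧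
        ∀ s t, dist s t ≤ dδ s t ∧ dδ s t ≤ (1 + δ) * dist s t) ∧
      (upperMinkowskiDim T < ⊤ → ∀ s : ℝ, 2 * upperMinkowskiDim T < (s : EReal) →
        IsSummable (pairDirac J) s) ∧
      (ConnectedSpace T → ∀ s : ℝ, 0 < s → IsSummable (pairDirac J) s →
        upperMinkowskiDim T ≤ (s : EReal)) := by
  have hθ0 : (0 : ℝ) < θ := by exact_mod_cast hθ
  have hρ0 : (0 : ℝ) < ρ := by exact_mod_cast hρ
  have hρ1' : (ρ : ℝ) < 1 := by exact_mod_cast hρ1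
  have hfin : ∀ n, (C n).Finite := fun n => (hC n).finite (mul_pos hθ (pow_pos hρ n)).ne'
  -- `3 ≤ K` admits the pairs of length at most `3 * r_n` used in the connected case; the other two
  -- conditions are those of the Lipschitz estimate.
  obtain ⟨K, hK3, hK, hKdiam⟩ : ∃ K : ℝ, 3 ≤ K ∧
      (2 * ((1 + (ρ : ℝ)) / (1 - ρ)) + 2) / (ρ * δ) ≤ K - 2 ∧
      Metric.diam (Set.univ : Set T) / θ ≤ K - 2 := by
    refine ⟨3 + |(2 * ((1 + (ρ : ℝ)) / (1 - ρ)) + 2) / (ρ * δ)| +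
      |Metric.diam (Set.univ : Set T) / θ|, ?_, ?_, ?_⟩ <;>
    linarith [le_abs_self ((2 * ((1 + (ρ : ℝ)) / (1 - ρ)) + 2) / (ρ * δ)),
      abs_nonneg ((2 * ((1 + (ρ : ℝ)) / (1 - ρ)) + 2) / (ρ * δ)),
      le_abs_self (Metric.diam (Set.univ : Set T) / θ),
      abs_nonneg (Metric.diam (Set.univ : Set T) / θ)]
  let R : ℕ → ℝ := fun n => K * (θ * ρ ^ n)
  have hR : Filter.Tendsto R Filter.atTop (nhds 0) := by
    simpa using ((tendsto_pow_atTop_nhds_zero_of_lt_one hρ0.le hρ1').const_mul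
      (θ : ℝ)).const_mul K
  have hS : ∀ p ∈ ⋃ n, levelPairs C R n, p.1 ≠ p.2 := fun p hp => by
    obtain ⟨n, hn⟩ := Set.mem_iUnion.1 hp
    exact hn.1
  obtain ⟨J, hJS, hanti, hcov⟩ := exists_orientation _ hS
  have hJ : ∀ p ∈ J, p.1 ≠ p.2 := fun p hp => hS p (hJS hp)
  have hcov' : ∀ n x y, (x, y) ∈ levelPairs C R n → (x, y) ∈ J ∨ (y, x) ∈ J := fun n x y h =>
    hcov x y (Set.mem_iUnion.2 ⟨n, h⟩)
  refine ⟨J, ?_, hanti, fun x y h => ?_, ?_, ?_, fun _ s hs => ?_, fun hT s hs hsum => ?_⟩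
  · exact (Set.countable_iUnion fun n => (finite_levelPairs hfin R n).countable).mono hJS
  · obtain ⟨n, hn⟩ := Set.mem_iUnion.1 (hJS h)
    exact ⟨n, hn.2.1, hn.2.2.1⟩
  · exact isSpectralTriple_pair hJ fun ε hε => finite_le_dist_of_subset_levelPairs hfin hR hJS hε
  · refine exists_metric_of_lipschitz_bound hJ (by linarith) fun f hf s t => ?_
    refine norm_sub_le_of_levelPairs (C := C) hθ0 hρ0 hρ1' hδ (fun n x => ?_) (by linarith) hK
      (fun x y => ?_) f.continuous (fun n p hp => ?_) s t
    · simpa using (hC n).exists_dist_le x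
    · rw [div_le_iff₀ hθ0] at hKdiam
      exact (Metric.dist_le_diam_of_mem isCompact_univ.isBounded (Set.mem_univ x)
        (Set.mem_univ y)).trans hKdiam
    -- `J` may contain only the reverse of `p`, but the Lipschitz condition is symmetric.
    · rcases hcov' n p.1 p.2 hp with h | h
      · exact hf _ h
      · rw [norm_sub_rev, dist_comm]
        exact hf _ h
  · exact isSummable_of_subset_levelPairs hθ hρ hρ1 hC (by linarith) hJS hs
  · exact upperMinkowskiDim_le_of_isSummable hθ hρ hρ1 hC hK3 hcov' hs hsum
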